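/- **Signal recovery for the low-rank matrix single index model.** Let $p_0:\mathbb R\to[0,\infty)$ be a differentiable probability density with score $s_0=-p_0'/p_0$, let $f:\mathbb R\to\mathbb R$ be differentiable, and let $\beta^*\in\mathbb R^{d_1\times d_2}$ have rank $r^*$ and $\|\beta^*\|_{\mathrm F}=1$. Consider the model $$Y=f(\langle X,\beta^*\rangle)+\epsilon ,\qquad \langle A,B\rangle=\operatorname{tr}(A^\top B),$$ where the entries of $X\in\mathbb R^{d_1\times d_2}$ are i.i.d. with density $p_0$, the noise $\epsilon$ is independent of $X$ with $\mathbb E[\epsilon]=0$, and $\mu=\mathbb E[f'(\langle X,\beta^*\rangle)]$ exists and is nonzero. Let $S(X)$ be the matrix obtained by applying $s_0$ to each entry of $X$, and assume that for some $M>0$ $$\mathbb E[Y^4]\le M,\qquad \mathbb E[s_0(U)^4]\le M\quad\text{for } U \text{ with density } p_0 .$$ Let $(X_i,Y_i)_{i=1}^n$, $n\ge1$, be i.i.d. copies of $(X,Y)$. Let $\phi:\mathbb R\to\mathbb R$ be any non-decreasing function with $$-\log(1-x+x^2/2)\le\phi(x)\le\log(1+x+x^2/2)\qquad\text{for all }x\in\mathbb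 R .$$ For $A\in\mathbb R^{d_1\times d_2}$ let $\tilde A=\begin{bmatrix}0&A\\A^\top&0\end{bmatrix}=\Upsilon\Lambda\Upsilon^\top$ be an eigenvalue decomposition, and let $\psi(A)\in\mathbb R^{d_1\times d_2}$ be the upper-right block of $\Upsilon\,\operatorname{diag}(\phi(\Lambda_{11}),\phi(\Lambda_{22}),\dots)\,\Upsilon^\top$. Put $$\kappa=\frac{2\sqrt{\log(d_1+d_2)}}{\sqrt{n\,(d_1+d_2)\,M}},\qquad \lambda=C\sqrt{\frac{M(d_1+d_2)\log(d_1+d_2)}{n}},\qquad T_i=\frac1\kappa\,\psi\bigl(\kappa\,Y_i\,S(X_i)\bigr),$$ and let $\hat\beta$ be the solution of $$\min_{\beta\in\mathbb R^{d_1\times d_2}}\ \langle\beta,\beta\rangle-\frac2n\sum_{i=1}^n\langle T_i,\beta\rangle+\lambda\|\beta\|_* ,$$ where $\|\cdot\|_*$ is the nuclear norm. Then there is an absolute constant $C>0$ (independent of $n,d_1,d_2,r^*,M,p_0,f,\beta^*,\phi$ and the law of $\epsilon$) such that, with probability at least $1-(d_1+d_2)^{-2}$, $$\|\hat\beta-\mu\beta^*\|_{\mathrm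 F}\le 3\sqrt{r^*}\,\lambda\qquad\text{and}\qquad\|\hat\beta-\mu\beta^*\|_*\le 12\,r^*\lambda .$$ -/

import Mathlib

open MeasureTheory ProbabilityTheory Matrix
open scoped Matrix.Norms.Frobenius

namespace LowRankSIM

/-- Real matrices carry the product (equivalently, Borel) sigma-algebra. -/
instance matrixMeasurableSpace (d₁ d₂ : ℕ) : MeasurableSpace (Matrix (Fin d₁) (Fin d₂) ℝ) :=
  inferInstanceAs (MeasurableSpace (Fin d₁ → Fin d₂ → ℝ))

/-- The trace inner product `⟨A, B⟩ = tr (Aᵀ B)`. -/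
def traceInner {d₁ d₂ : ℕ} (A B : Matrix (Fin d₁) (Fin d₂) ℝ) : ℝ :=
  (Aᵀ * B).trace

/-- The nuclear norm: the sum of the singular values of `A`, that is, of the square roots of the
eigenvalues (with multiplicity) of `Aᵀ A`. (Over `ℝ`, `Aᴴ` is `Aᵀ`.) -/
noncomputable def nuclearNorm {d₁ d₂ : ℕ} (A : Matrix (Fin d₁) (Fin d₂) ℝ) : ℝ :=
  ∑ j, √((isHermitian_conjTranspose_mul_self A).eigenvalues j)

/-- The law on `ℝ` with density `p₀` with respect to Lebesgue measure. -/
noncomputable def entryLaw (p₀ : ℝ → ℝ) : Measure ℝ :=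
  volume.withDensity fun u => ENNReal.ofReal (p₀ u)

/-- The law of a random `d₁ × d₂` matrix whose entries are i.i.d. with density `p₀`. -/
noncomputable def covariateLaw (d₁ d₂ : ℕ) (p₀ : ℝ → ℝ) : Measure (Matrix (Fin d₁) (Fin d₂) ℝ) :=
  Measure.pi fun _ : Fin d₁ => Measure.pi fun _ : Fin d₂ => entryLaw p₀

/-- The univariate score function `s₀ = - p₀' / p₀`. -/
noncomputable def score₀ (p₀ : ℝ → ℝ) (u : ℝ) : ℝ :=
  -deriv p₀ u / p₀ u

/-- The score function `S` of the density `x ↦ ∏ p₀ (x j k)`: `s₀` applied to every entry. -/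
noncomputable def score {d₁ d₂ : ℕ} (p₀ : ℝ → ℝ) (x : Matrix (Fin d₁) (Fin d₂) ℝ) :
    Matrix (Fin d₁) (Fin d₂) ℝ :=
  x.map (score₀ p₀)

/-- The rank-`r` matrix single index model with a first-order link,
`Y = f (⟨X, β*⟩) + ε`, where the entries of `X` are i.i.d. with density `p₀` and the noise `ε` is
centred and independent of `X`. The norm `‖βstar‖` is the Frobenius norm. -/
structure MatrixSIM (d₁ d₂ r : ℕ) where
  /-- the density of the entries of the covariate -/
  p₀ : ℝ → ℝ
  /-- the link function -/
  f : ℝ → ℝ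
  /-- the signal -/
  βstar : Matrix (Fin d₁) (Fin d₂) ℝ
  /-- the law of the noise -/
  noise : Measure ℝ
  p₀_nonneg : ∀ u, 0 ≤ p₀ u
  p₀_integral : ∫ u, p₀ u = 1
  p₀_differentiable : Differentiable ℝ p₀
  f_differentiable : Differentiable ℝ f
  rank_βstar : βstar.rank = r
  norm_βstar : ‖βstar‖ = 1
  noise_prob : IsProbabilityMeasure noise
  noise_integrable : Integrable (fun e => e) noise
  noise_mean : ∫ e, e ∂noise = 0
  link_integrable : Integrable (fun x => deriv f (traceInner x βstar)) (covariateLaw d₁ d₂ p₀)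
  link_ne_zero : ∫ x, deriv f (traceInner x βstar) ∂(covariateLaw d₁ d₂ p₀) ≠ 0

/-- The scaling constant `μ = E [f' (⟨X, β*⟩)]`. -/
noncomputable def MatrixSIM.mu {d₁ d₂ r : ℕ} (m : MatrixSIM d₁ d₂ r) : ℝ :=
  ∫ x, deriv m.f (traceInner x m.βstar) ∂(covariateLaw d₁ d₂ m.p₀)

/-- The law of a pair `(X, Y)` with `Y = f (⟨X, β*⟩) + ε`, `ε` independent of `X`. -/
noncomputable def MatrixSIM.dataLaw {d₁ d₂ r : ℕ} (m : MatrixSIM d₁ d₂ r) :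
    Measure (Matrix (Fin d₁) (Fin d₂) ℝ × ℝ) :=
  ((covariateLaw d₁ d₂ m.p₀).prod m.noise).map
    fun z => (z.1, m.f (traceInner z.1 m.βstar) + z.2)

/-- The fourth-moment assumption: `E [Y⁴] ≤ M` and `E [s₀(U)⁴] ≤ M` for `U` with density `p₀`. -/
structure MatrixSIM.MomentBound {d₁ d₂ r : ℕ} (m : MatrixSIM d₁ d₂ r) (M : ℝ) : Prop where
  response_integrable : Integrable (fun z => z.2 ^ 4) m.dataLaw
  response_bound : ∫ z, z.2 ^ 4 ∂m.dataLaw ≤ M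
  score_integrable : Integrable (fun u => score₀ m.p₀ u ^ 4) (entryLaw m.p₀)
  score_bound : ∫ u, score₀ m.p₀ u ^ 4 ∂(entryLaw m.p₀) ≤ M

/-- `(X i, Y i)`, `i < n`, are i.i.d. observations from the model. -/
structure MatrixSIM.IsSample {d₁ d₂ r n : ℕ} (m : MatrixSIM d₁ d₂ r) {Ω : Type*}
    [MeasurableSpace Ω] (P : Measure Ω) (X : Fin n → Ω → Matrix (Fin d₁) (Fin d₂) ℝ)
    (Y : Fin n → Ω → ℝ) : Prop where
  hasLaw : ∀ i, HasLaw (fun ω => (X i ω, Y i ω)) m.dataLaw P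
  indep : iIndepFun (fun i ω => (X i ω, Y i ω)) P

/-- The admissible (Catoni-type) influence functions. -/
def IsInfluence (φ : ℝ → ℝ) : Prop :=
  Monotone φ ∧ ∀ x : ℝ,
    -Real.log (1 - x + x ^ 2 / 2) ≤ φ x ∧ φ x ≤ Real.log (1 + x + x ^ 2 / 2)

/-- The symmetric dilation `[[0, A], [Aᵀ, 0]]` is symmetric. -/
theorem dilation_isHermitian {d₁ d₂ : ℕ} (A : Matrix (Fin d₁) (Fin d₂) ℝ) :
    (Matrix.fromBlocks 0 A Aᵀ 0).IsHermitian := by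
  refine Matrix.IsHermitian.fromBlocks Matrix.isHermitian_zero ?_ Matrix.isHermitian_zero
  rw [Matrix.conjTranspose_eq_transpose_of_trivial]

/-- The spectral truncation `ψ`: apply `φ` to the eigenvalues of the symmetric dilation of `A`
(in an orthonormal eigenbasis) and take the upper right `d₁ × d₂` block. Here
`Matrix.IsHermitian.cfc` is `U * diagonal (φ ∘ eigenvalues) * Uᵀ`. -/
noncomputable def spectralTrunc {d₁ d₂ : ℕ} (φ : ℝ → ℝ) (A : Matrix (Fin d₁) (Fin d₂) ℝ) :
    Matrix (Fin d₁) (Fin d₂) ℝ :=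
  ((dilation_isHermitian A).cfc φ).toBlocks₁₂

/-- The truncated version `κ⁻¹ ψ (κ y S(x))` of `y S(x)`. -/
noncomputable def truncated {d₁ d₂ : ℕ} (φ p₀ : ℝ → ℝ) (κ y : ℝ)
    (x : Matrix (Fin d₁) (Fin d₂) ℝ) : Matrix (Fin d₁) (Fin d₂) ℝ :=
  (1 / κ) • spectralTrunc φ ((κ * y) • score p₀ x)

/-- The loss `L(β) = ⟨β, β⟩ - (2 / n) ∑ i, ⟨T i, β⟩`. -/
noncomputable def loss {d₁ d₂ n : ℕ} (T : Fin n → Matrix (Fin d₁) (Fin d₂) ℝ)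
    (β : Matrix (Fin d₁) (Fin d₂) ℝ) : ℝ :=
  traceInner β β - (2 / n) * ∑ i, traceInner (T i) β

/-- `β` minimizes the nuclear-norm regularized loss built from the data `(x i, y i)` over all
`d₁ × d₂` matrices. -/
def IsEstimator {d₁ d₂ n : ℕ} (φ p₀ : ℝ → ℝ) (κ lam : ℝ)
    (x : Fin n → Matrix (Fin d₁) (Fin d₂) ℝ) (y : Fin n → ℝ)
    (β : Matrix (Fin d₁) (Fin d₂) ℝ) : Prop :=
  IsMinOn (fun b => loss (fun i => truncated φ p₀ κ (y i) (x i)) b + lam * nuclearNorm b)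
    Set.univ β

/-- The truncation level
`κ = 2 √(log (d₁ + d₂)) / √(n (d₁ + d₂) M)`. -/
noncomputable def kappa (d₁ d₂ n : ℕ) (M : ℝ) : ℝ :=
  2 * √(Real.log ((d₁ : ℝ) + d₂)) / √((n : ℝ) * ((d₁ : ℝ) + d₂) * M)

/-- The regularization parameter `λ = C √(M (d₁ + d₂) log (d₁ + d₂) / n)`. -/
noncomputable def lambda (d₁ d₂ n : ℕ) (M C : ℝ) : ℝ :=
  C * √(M * ((d₁ : ℝ) + d₂) * Real.log ((d₁ : ℝ) + d₂) / n)

end LowRankSIM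

open LowRankSIM

/-! Stein's identity gives `E[Y S(X)] = μ β*`: integrating by parts in one entry of `X` turns the
score into a derivative of the link. The loss sees the data only through the average of the `T_i`,
so the estimator is penalized least squares with that average as a noisy observation of `μ β*`. Two
matters remain.

Deterministic (`penalized_error_bound`): if the observation is within `λ/4` of `μ β*` in operator
norm, duality of operator and nuclear norm together with decomposability (`nuclearNorm_add_ge`)
bounds the errors by `2√r λ` and `6 r λ`, inside the claimed 3 and 12.

Probabilistic (`MomentBound.measure_operator_deviation_le`): only fourth moments are available,
whence the truncation. Let `Z` be the dilation of `κ Y S(X)`, `Φ = φ(Z)` and `B = E Φ`. The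
conditions on `φ` give `e^φ + e^{-φ} ≤ 2 + x²`, with no linear term. Midpoint convexity of the trace
exponential splits `S + (Φ - B)/2` into `S + Φ` and `S - B`; the gradient inequality trades `S - B`
for `S - Φ` up to a term of mean zero; Golden–Thompson leaves `tr(e^S (e^Φ + e^{-Φ}))`. Hence each
observation multiplies the expected trace exponential by at most `1 + ρ`, where `E Z² ≤ 2ρ`. This
takes the place of Lieb's concavity theorem. Markov's inequality then controls the fluctuation, and
`|φ(x) - x| ≤ x²/2` the bias.

Fourth moments of score sums along rows and columns give `ρ = κ²(d₁+d₂)M = 4 log(d₁+d₂)/n`. At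
Markov level `8 log(d₁+d₂)` the operator deviation is `10 √(M(d₁+d₂) log(d₁+d₂)/n)`, so `C = 40`
makes it `λ/4`. -/

namespace LowRankSIM

/-! ### Trace inequalities for powers of two. -/

section TracePower

variable {ι : Type*} [Fintype ι]

theorem trace_mul_transpose_nonneg {κ : Type*} [Fintype κ] (A : Matrix ι κ ℝ) :
    0 ≤ (A * Aᵀ).trace := by
  simp only [Matrix.trace, Matrix.diag, Matrix.mul_apply, Matrix.transpose_apply]
  exact Finset.sum_nonneg fun i _ => Finset.sum_nonneg fun j _ => mul_self_nonneg _

theorem two_mul_trace_mul_le (A B : Matrix ι ι ℝ) :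
    2 * (A * B).trace ≤ (A * Aᵀ).trace + (Bᵀ * B).trace := by
  have h := trace_mul_transpose_nonneg (A - Bᵀ)
  have h1 : (Bᵀ * Aᵀ).trace = (A * B).trace := by
    rw [← Matrix.transpose_mul, Matrix.trace_transpose]
  simp only [Matrix.transpose_sub, Matrix.transpose_transpose, Matrix.sub_mul, Matrix.mul_sub,
    Matrix.trace_sub, h1] at h
  linarith

variable [DecidableEq ι]

theorem trace_mul_pow_comm (A B : Matrix ι ι ℝ) (k : ℕ) :
    ((A * B) ^ k).trace = ((B * A) ^ k).trace := by
  cases k with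
  | zero => simp
  | succ k =>
    have h : B * (A * B) ^ k = (B * A) ^ k * B :=
      (SemiconjBy.pow_right (show SemiconjBy B (A * B) (B * A) by
        simp only [SemiconjBy, mul_assoc]) k)
    rw [pow_succ', mul_assoc, Matrix.trace_mul_comm, h, pow_succ, ← mul_assoc]

/-- Two-power forms of Weyl's majorant inequality and of the Lieb-Thirring trace inequality,
proved by simultaneous induction. -/
theorem trace_pow_two_pow_le (k : ℕ) :
    (∀ X : Matrix ι ι ℝ, (X ^ 2 ^ (k + 1)).trace ≤ ((X * Xᵀ) ^ 2 ^ k).trace) ∧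
    (∀ A B : Matrix ι ι ℝ, Aᵀ = A → Bᵀ = B →
      ((A * B) ^ 2 ^ k).trace ≤ (A ^ 2 ^ k * B ^ 2 ^ k).trace) := by
  induction k with
  | zero =>
    refine ⟨fun X => ?_, fun A B _ _ => by simp⟩
    have h := two_mul_trace_mul_le X X
    rw [Matrix.trace_mul_comm Xᵀ X] at h
    simp only [zero_add, pow_one, pow_zero, pow_two]
    linarith
  | succ k ih =>
    obtain ⟨ihX, ihAB⟩ := ih
    constructor
    · intro X
      set A := Xᵀ * X with hA
      set B := X * Xᵀ with hB
      have hAt : Aᵀ = A := by simp [hA]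
      have hBt : Bᵀ = B := by simp [hB]
      -- The Weyl half at level `k` is applied to `X²`; cyclically, `X²(X²)ᵀ` becomes `(XᵀX)(XXᵀ)`,
      -- where the Lieb–Thirring half applies. The arithmetic–geometric inequality then separates
      -- the two factors, whose powers have equal traces.
      have h1 : (X ^ 2 ^ (k + 1 + 1)).trace ≤ ((A * B) ^ 2 ^ k).trace := by
        have h := ihX (X ^ 2)
        rw [← pow_mul, ← pow_succ'] at h
        have h2 : X ^ 2 * (X ^ 2)ᵀ = X * (X * Xᵀ * Xᵀ) := by
          simp only [pow_two, Matrix.transpose_mul, mul_assoc]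
        have h3 : X * Xᵀ * Xᵀ * X = B * A := by simp only [hA, hB, mul_assoc]
        rw [h2, trace_mul_pow_comm, h3, trace_mul_pow_comm] at h
        exact h
      have h4 := two_mul_trace_mul_le (A ^ 2 ^ k) (B ^ 2 ^ k)
      rw [Matrix.transpose_pow, Matrix.transpose_pow, hAt, hBt, ← pow_add, ← pow_add, ← two_mul,
        ← pow_succ'] at h4
      have h5 : (A ^ 2 ^ (k + 1)).trace = (B ^ 2 ^ (k + 1)).trace := trace_mul_pow_comm _ _ _
      linarith [ihAB A B hAt hBt]
    · intro A B hA hB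
      -- Cyclically, `AB(AB)ᵀ = AB²A` becomes `B²A²`, and the Lieb–Thirring half applies to the
      -- squares. No positivity of `A` or `B` is needed.
      have h := ihX (A * B)
      have h2 : A * B * (A * B)ᵀ = A * (B * B * A) := by
        rw [Matrix.transpose_mul, hA, hB]; simp only [mul_assoc]
      have h3 : B * B * A * A = B ^ 2 * A ^ 2 := by simp only [pow_two, mul_assoc]
      rw [h2, trace_mul_pow_comm A (B * B * A), h3, trace_mul_pow_comm (B ^ 2)] at h
      refine h.trans ((ihAB (A ^ 2) (B ^ 2) ?_ ?_).trans_eq ?_)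
      · rw [Matrix.transpose_pow, hA]
      · rw [Matrix.transpose_pow, hB]
      · rw [← pow_mul, ← pow_mul, ← pow_succ']

end TracePower

/-! ### The Lie–Trotter product formula. -/

section Trotter

open Filter Topology

theorem norm_pow_sub_pow_le_of_norm_le {𝔸 : Type*} [NormedRing 𝔸] [NormOneClass 𝔸] {x y : 𝔸}
    {c : ℝ} (hc : 1 ≤ c) (hx : ‖x‖ ≤ c) (hy : ‖y‖ ≤ c) (m : ℕ) :
    ‖x ^ m - y ^ m‖ ≤ m * ‖x - y‖ * c ^ m := by
  induction m with
  | zero => simp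
  | succ m ih =>
    have h : x ^ (m + 1) - y ^ (m + 1) = x ^ m * (x - y) + (x ^ m - y ^ m) * y := by
      rw [pow_succ, pow_succ]; noncomm_ring
    have hxm : ‖x ^ m‖ ≤ c ^ m := (norm_pow_le x m).trans (by gcongr)
    have hcm : c ^ m ≤ c ^ (m + 1) := pow_le_pow_right₀ hc (Nat.le_succ m)
    calc ‖x ^ (m + 1) - y ^ (m + 1)‖
        ≤ ‖x ^ m‖ * ‖x - y‖ + ‖x ^ m - y ^ m‖ * ‖y‖ := by
          rw [h]
          exact (norm_add_le _ _).trans (add_le_add (norm_mul_le _ _) (norm_mul_le _ _))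
      _ ≤ c ^ (m + 1) * ‖x - y‖ + m * ‖x - y‖ * c ^ m * c := by
          gcongr
          exact hxm.trans hcm
      _ = ((m + 1 : ℕ) : ℝ) * ‖x - y‖ * c ^ (m + 1) := by push_cast; ring

/-- Two curves through 1 with the same derivative differ by `o(1/m)` at time `1/m`. Telescoping the
`m`-th powers costs a factor `m`, and both norms are at most `e^{C/m}`, whose `m`-th power stays
equal to `e^C`. -/
theorem tendsto_pow_sub_pow_of_hasDerivAt {𝔸 : Type*} [NormedRing 𝔸] [NormOneClass 𝔸]
    [NormedAlgebra ℝ 𝔸] {f g : ℝ → 𝔸} {D : 𝔸} (hf : HasDerivAt f D 0) (hg : HasDerivAt g D 0)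
    (hf0 : f 0 = 1) (hg0 : g 0 = 1) :
    Tendsto (fun m : ℕ => f (1 / (m : ℝ)) ^ m - g (1 / (m : ℝ)) ^ m) atTop (𝓝 0) := by
  have bound : ∀ {h : ℝ → 𝔸}, HasDerivAt h D 0 → h 0 = 1 →
      ∃ C : ℝ, 0 ≤ C ∧ ∀ᶠ t in 𝓝 (0 : ℝ), ‖h t‖ ≤ 1 + C * |t| := by
    intro h hh h0
    obtain ⟨C, hC, hb⟩ := hh.differentiableAt.isBigO_sub.exists_nonneg
    refine ⟨C, hC, hb.bound.mono fun t ht => ?_⟩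
    rw [h0, sub_zero, Real.norm_eq_abs] at ht
    calc ‖h t‖ = ‖1 + (h t - 1)‖ := by congr 1; abel
      _ ≤ ‖(1 : 𝔸)‖ + ‖h t - 1‖ := norm_add_le _ _
      _ ≤ 1 + C * |t| := by rw [norm_one]; gcongr
  obtain ⟨C₁, hC₁, hb₁⟩ := bound hf hf0
  obtain ⟨C₂, hC₂, hb₂⟩ := bound hg hg0
  have hlim : Tendsto (fun m : ℕ => 1 / (m : ℝ)) atTop (𝓝 0) :=
    tendsto_one_div_atTop_nhds_zero_nat
  have hdiff : (fun t => f t - g t) =o[𝓝 0] fun t : ℝ => t := by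
    have h := (hasDerivAt_iff_isLittleO.mp (hf.sub hg))
    simpa [hf0, hg0] using h
  have hlit := hdiff.comp_tendsto hlim
  have hmul : Tendsto (fun m : ℕ => ‖(m : ℝ) • (f (1 / (m : ℝ)) - g (1 / (m : ℝ)))‖) atTop
      (𝓝 0) := by
    have h := hlit.norm_left.tendsto_div_nhds_zero
    refine h.congr' ?_
    filter_upwards [eventually_gt_atTop 0] with m hm
    have : (0 : ℝ) < m := by exact_mod_cast hm
    simp only [Function.comp_apply, norm_smul, Real.norm_eq_abs, abs_of_pos this]
    field_simp
  set C := C₁ + C₂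
  have hfin : Tendsto (fun m : ℕ => ‖(m : ℝ) • (f (1 / (m : ℝ)) - g (1 / (m : ℝ)))‖ * Real.exp C)
      atTop (𝓝 0) := by simpa using hmul.mul_const (Real.exp C)
  refine squeeze_zero_norm' ?_ hfin
  filter_upwards [hlim.eventually hb₁, hlim.eventually hb₂, eventually_gt_atTop 0] with m h1 h2 hm
  have hm' : (0 : ℝ) < m := by exact_mod_cast hm
  have habs : |1 / (m : ℝ)| = 1 / m := abs_of_pos (by positivity)
  rw [habs] at h1 h2
  have hc : ∀ {C' : ℝ}, C' ≤ C → 1 + C' * (1 / (m : ℝ)) ≤ Real.exp (C / m) := by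
    intro C' hC'
    have : C' * (1 / (m : ℝ)) ≤ C / m := by
      rw [mul_one_div]; gcongr
    linarith [Real.add_one_le_exp (C / m)]
  have hC : 0 ≤ C / m := by positivity
  refine (norm_pow_sub_pow_le_of_norm_le (Real.one_le_exp hC) (h1.trans (hc ?_))
    (h2.trans (hc ?_)) m).trans_eq ?_
  · simp only [C]; linarith
  · simp only [C]; linarith
  · rw [norm_smul, Real.norm_eq_abs, abs_of_pos hm', ← Real.exp_nat_mul]
    congr 2
    field_simp

/-- The Lie-Trotter product formula. -/
theorem tendsto_exp_mul_exp_pow {𝔸 : Type*} [NormedRing 𝔸] [NormOneClass 𝔸]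
    [NormedAlgebra ℝ 𝔸] [CompleteSpace 𝔸] (a b : 𝔸) :
    Tendsto (fun m : ℕ => (NormedSpace.exp ((1 / (m : ℝ)) • a) *
      NormedSpace.exp ((1 / (m : ℝ)) • b)) ^ m) atTop (𝓝 (NormedSpace.exp (a + b))) := by
  have hd : ∀ x : 𝔸, HasDerivAt (fun t : ℝ => NormedSpace.exp (t • x)) x 0 := fun x => by
    simpa using hasDerivAt_exp_smul_const (𝕂 := ℝ) x (0 : ℝ)
  have hf : HasDerivAt (fun t : ℝ => NormedSpace.exp (t • a) * NormedSpace.exp (t • b))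
      (a + b) 0 := by
    convert! (hd a).mul (hd b) using 1
    simp
  have h := tendsto_pow_sub_pow_of_hasDerivAt hf (hd (a + b)) (by simp) (by simp)
  have h2 := h.add_const (NormedSpace.exp (a + b))
  rw [zero_add] at h2
  refine h2.congr' ?_
  filter_upwards [eventually_gt_atTop 0] with m hm
  have hm' : (m : ℝ) ≠ 0 := by exact_mod_cast hm.ne'
  have : NormedSpace.exp ((1 / (m : ℝ)) • (a + b)) ^ m = NormedSpace.exp (a + b) := by
    let : NormedAlgebra ℚ 𝔸 := NormedAlgebra.restrictScalars ℚ ℝ 𝔸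
    rw [← NormedSpace.exp_nsmul, ← Nat.cast_smul_eq_nsmul ℝ, smul_smul, mul_one_div_cancel hm',
      one_smul]
  rw [this, sub_add_cancel]

end Trotter

/-! ### The Golden–Thompson inequality. -/

section GoldenThompson

variable {ι : Type*} [Fintype ι] [DecidableEq ι]

open Filter Topology

theorem tendsto_matrix_exp_mul_exp_pow (A B : Matrix ι ι ℝ) :
    Tendsto (fun m : ℕ => (NormedSpace.exp ((1 / (m : ℝ)) • A) *
      NormedSpace.exp ((1 / (m : ℝ)) • B)) ^ m) atTop (𝓝 (NormedSpace.exp (A + B))) := by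
  -- A norm with `‖1‖ = 1` is needed. The Frobenius norm fails this in dimension above one, so the
  -- operator norm for `ℓ^∞` is used; the empty index type must be set apart.
  cases isEmpty_or_nonempty ι with
  | inl h => exact tendsto_const_nhds.congr fun m => Subsingleton.elim _ _
  | inr h =>
    let : NormedRing (Matrix ι ι ℝ) := Matrix.linftyOpNormedRing
    let : NormedAlgebra ℝ (Matrix ι ι ℝ) := Matrix.linftyOpNormedAlgebra
    have : NormOneClass (Matrix ι ι ℝ) := Matrix.linfty_opNormOneClass
    refine @tendsto_exp_mul_exp_pow _ _ _ _ ?_ A B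
    exact inferInstanceAs (CompleteSpace (ι → ι → ℝ))

/-- The Golden-Thompson inequality. -/
theorem trace_exp_add_le {A B : Matrix ι ι ℝ} (hA : Aᵀ = A) (hB : Bᵀ = B) :
    (NormedSpace.exp (A + B)).trace ≤ (NormedSpace.exp A * NormedSpace.exp B).trace := by
  -- The subsequence `m = 2^k` of the Trotter limit is enough, and there the trace inequality for
  -- powers of two applies.
  have h1 := (tendsto_matrix_exp_mul_exp_pow A B).comp
    (tendsto_pow_atTop_atTop_of_one_lt (one_lt_two (α := ℕ)))
  have h2 := ((continuous_id.matrix_trace).tendsto (NormedSpace.exp (A + B))).comp h1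
  refine le_of_tendsto h2 (Eventually.of_forall fun k => ?_)
  have hm' : ((2 ^ k : ℕ) : ℝ) ≠ 0 := by positivity
  have hpow : ∀ M : Matrix ι ι ℝ,
      NormedSpace.exp ((1 / ((2 ^ k : ℕ) : ℝ)) • M) ^ 2 ^ k = NormedSpace.exp M := fun M => by
    rw [← Matrix.exp_nsmul, ← Nat.cast_smul_eq_nsmul ℝ, smul_smul, mul_one_div_cancel hm',
      one_smul]
  have ht : ∀ M : Matrix ι ι ℝ, Mᵀ = M → (NormedSpace.exp ((1 / ((2 ^ k : ℕ) : ℝ)) • M))ᵀ =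
      NormedSpace.exp ((1 / ((2 ^ k : ℕ) : ℝ)) • M) := fun M hM => by
    rw [← Matrix.exp_transpose, Matrix.transpose_smul, hM]
  have h := (trace_pow_two_pow_le k).2 _ _ (ht A hA) (ht B hB)
  rw [hpow, hpow] at h
  exact h

end GoldenThompson

/-! ### Functional calculus of symmetric matrices and convexity of the trace exponential. -/

section SpectralCalculus

theorem transpose_eq_of_isHermitian {ι : Type*} {H : Matrix ι ι ℝ} (hH : H.IsHermitian) : Hᵀ = H := by
  rw [← Matrix.conjTranspose_eq_transpose_of_trivial]; exact hH

theorem isHermitian_of_transpose_eq {ι : Type*} {H : Matrix ι ι ℝ} (hH : Hᵀ = H) : H.IsHermitian := by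
  rw [Matrix.IsHermitian, Matrix.conjTranspose_eq_transpose_of_trivial, hH]

variable {ι : Type*} [Fintype ι] [DecidableEq ι] {H : Matrix ι ι ℝ}

/-- The orthogonal matrix of eigenvectors of a real symmetric matrix. -/
noncomputable def eigU (hH : H.IsHermitian) : Matrix ι ι ℝ :=
  (hH.eigenvectorUnitary : Matrix ι ι ℝ)

theorem eigU_mul_transpose (hH : H.IsHermitian) : eigU hH * (eigU hH)ᵀ = 1 := by
  rw [← Matrix.conjTranspose_eq_transpose_of_trivial]
  exact Unitary.coe_mul_star_self hH.eigenvectorUnitary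

theorem transpose_mul_eigU (hH : H.IsHermitian) : (eigU hH)ᵀ * eigU hH = 1 := by
  rw [← Matrix.conjTranspose_eq_transpose_of_trivial]
  exact Unitary.coe_star_mul_self hH.eigenvectorUnitary

theorem cfc_eq_eigU (hH : H.IsHermitian) (f : ℝ → ℝ) :
    hH.cfc f = eigU hH * diagonal (fun i => f (hH.eigenvalues i)) * (eigU hH)ᵀ := by
  rw [← Matrix.conjTranspose_eq_transpose_of_trivial]
  rfl

theorem cfc_mul_cfc (hH : H.IsHermitian) (f g : ℝ → ℝ) :
    hH.cfc f * hH.cfc g = hH.cfc fun x => f x * g x := by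
  simp only [cfc_eq_eigU]
  rw [show ∀ U D E V : Matrix ι ι ℝ, U * D * V * (U * E * V) = U * D * (V * U) * E * V by
    intros; simp only [mul_assoc], transpose_mul_eigU, mul_one, mul_assoc (eigU hH),
    diagonal_mul_diagonal]

theorem cfc_add_cfc (hH : H.IsHermitian) (f g : ℝ → ℝ) :
    hH.cfc f + hH.cfc g = hH.cfc fun x => f x + g x := by
  simp only [cfc_eq_eigU]
  rw [← add_mul, ← mul_add, diagonal_add]

theorem cfc_const_mul (hH : H.IsHermitian) (c : ℝ) (f : ℝ → ℝ) :
    (hH.cfc fun x => c * f x) = c • hH.cfc f := by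
  simp only [cfc_eq_eigU]
  rw [← Matrix.smul_mul, ← Matrix.mul_smul, ← diagonal_smul]
  rfl

theorem cfc_neg_eq (hH : H.IsHermitian) (f : ℝ → ℝ) :
    (hH.cfc fun x => -f x) = -hH.cfc f := by
  have h := cfc_const_mul hH (-1) f
  simpa using h

theorem cfc_one_eq (hH : H.IsHermitian) : (hH.cfc fun _ => 1) = 1 := by
  rw [cfc_eq_eigU, diagonal_one, mul_one, eigU_mul_transpose]

theorem cfc_id_eq (hH : H.IsHermitian) : (hH.cfc fun x => x) = H := by
  conv_rhs => rw [hH.spectral_theorem]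
  rfl

theorem cfc_sq_eq (hH : H.IsHermitian) : (hH.cfc fun x => x ^ 2) = H * H := by
  have h := cfc_mul_cfc hH (fun x => x) (fun x => x)
  rw [cfc_id_eq] at h
  rw [h]
  simp only [pow_two]

theorem transpose_cfc (hH : H.IsHermitian) (f : ℝ → ℝ) : (hH.cfc f)ᵀ = hH.cfc f := by
  simp only [cfc_eq_eigU, Matrix.transpose_mul, Matrix.transpose_transpose,
    Matrix.diagonal_transpose, mul_assoc]

theorem exp_cfc (hH : H.IsHermitian) (f : ℝ → ℝ) :
    NormedSpace.exp (hH.cfc f) = hH.cfc fun x => Real.exp (f x) := by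
  have hinv : (eigU hH)⁻¹ = (eigU hH)ᵀ := Matrix.inv_eq_right_inv (eigU_mul_transpose hH)
  have hu : IsUnit (eigU hH) := IsUnit.of_mul_eq_one _ (eigU_mul_transpose hH)
  rw [cfc_eq_eigU, cfc_eq_eigU, ← hinv, Matrix.exp_conj _ _ hu, Matrix.exp_diagonal]
  congr 3
  funext i
  rw [Pi.coe_exp, Real.exp_eq_exp_ℝ]

theorem exp_eq_cfc (hH : H.IsHermitian) : NormedSpace.exp H = hH.cfc Real.exp := by
  have h := exp_cfc hH (fun x => x)
  rwa [cfc_id_eq] at h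

/-- The `i`-th eigenvector as a plain vector. -/
noncomputable def eigVec (hH : H.IsHermitian) (i : ι) : ι → ℝ := fun k => eigU hH k i

theorem eigVec_dot_self (hH : H.IsHermitian) (i : ι) : eigVec hH i ⬝ᵥ eigVec hH i = 1 := by
  have h := congrFun (congrFun (transpose_mul_eigU hH) i) i
  rw [Matrix.one_apply_eq] at h
  exact h

theorem quad_cfc (hH : H.IsHermitian) (f : ℝ → ℝ) (w : ι → ℝ) :
    w ⬝ᵥ (hH.cfc f *ᵥ w) = ∑ i, f (hH.eigenvalues i) * (eigVec hH i ⬝ᵥ w) ^ 2 := by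
  rw [cfc_eq_eigU, ← Matrix.mulVec_mulVec, ← Matrix.mulVec_mulVec, Matrix.dotProduct_mulVec,
    ← Matrix.mulVec_transpose]
  simp only [dotProduct, Matrix.mulVec_diagonal]
  refine Finset.sum_congr rfl fun i _ => ?_
  have : ((eigU hH)ᵀ *ᵥ w) i = ∑ k, eigVec hH i k * w k := rfl
  rw [this]; ring

/-- The quadratic form is a combination, with nonnegative weights, of the function's values at the
eigenvalues. Scalar inequalities become matrix inequalities through this lemma. -/
theorem quad_cfc_mono (hH : H.IsHermitian) {f g : ℝ → ℝ} (hfg : ∀ x, f x ≤ g x) (w : ι → ℝ) :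
    w ⬝ᵥ (hH.cfc f *ᵥ w) ≤ w ⬝ᵥ (hH.cfc g *ᵥ w) := by
  rw [quad_cfc, quad_cfc]
  exact Finset.sum_le_sum fun i _ => mul_le_mul_of_nonneg_right (hfg _) (sq_nonneg _)

theorem sum_eigVec_dot_sq (hH : H.IsHermitian) (w : ι → ℝ) :
    ∑ i, (eigVec hH i ⬝ᵥ w) ^ 2 = w ⬝ᵥ w := by
  have h := quad_cfc hH (fun _ => 1) w
  rw [cfc_one_eq, Matrix.one_mulVec] at h
  simp only [one_mul] at h
  exact h.symm

theorem trace_cfc_mul (hH : H.IsHermitian) (f : ℝ → ℝ) (B : Matrix ι ι ℝ) :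
    (hH.cfc f * B).trace =
      ∑ i, f (hH.eigenvalues i) * (eigVec hH i ⬝ᵥ (B *ᵥ eigVec hH i)) := by
  rw [cfc_eq_eigU, mul_assoc, Matrix.trace_mul_comm, ← mul_assoc, Matrix.trace_mul_comm]
  simp only [Matrix.trace, Matrix.diag, Matrix.diagonal_mul]
  refine Finset.sum_congr rfl fun i _ => ?_
  rw [mul_assoc]
  rfl

theorem trace_cfc (hH : H.IsHermitian) (f : ℝ → ℝ) :
    (hH.cfc f).trace = ∑ i, f (hH.eigenvalues i) := by
  have h := trace_cfc_mul hH f 1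
  simpa [eigVec_dot_self] using h

theorem trace_eq_sum_quad (hH : H.IsHermitian) (B : Matrix ι ι ℝ) :
    B.trace = ∑ i, eigVec hH i ⬝ᵥ (B *ᵥ eigVec hH i) := by
  have h := trace_cfc_mul hH (fun _ => 1) B
  rw [cfc_one_eq] at h
  simpa using h

theorem mulVec_eigVec (hH : H.IsHermitian) (i : ι) :
    H *ᵥ eigVec hH i = hH.eigenvalues i • eigVec hH i :=
  hH.mulVec_eigenvectorBasis i

theorem quad_eigVec (hH : H.IsHermitian) (i : ι) :
    eigVec hH i ⬝ᵥ (H *ᵥ eigVec hH i) = hH.eigenvalues i := by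
  rw [mulVec_eigVec, dotProduct_smul, eigVec_dot_self, smul_eq_mul, mul_one]

/-- Multiplication by the (positive) exponential of a symmetric matrix is monotone under the
trace. -/
theorem trace_exp_mul_le {S A B : Matrix ι ι ℝ} (hS : S.IsHermitian)
    (hAB : ∀ w, w ⬝ᵥ (A *ᵥ w) ≤ w ⬝ᵥ (B *ᵥ w)) :
    (NormedSpace.exp S * A).trace ≤ (NormedSpace.exp S * B).trace := by
  rw [exp_eq_cfc hS, trace_cfc_mul, trace_cfc_mul]
  exact Finset.sum_le_sum fun i _ => mul_le_mul_of_nonneg_left (hAB _) (Real.exp_pos _).le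

/-- The gradient inequality expressing convexity of the trace exponential. -/
theorem trace_exp_gradient_le {A B : Matrix ι ι ℝ} (hA : A.IsHermitian) (hB : B.IsHermitian) :
    (NormedSpace.exp A).trace + (NormedSpace.exp A * (B - A)).trace ≤
      (NormedSpace.exp B).trace := by
  rw [exp_eq_cfc hA, trace_cfc_mul, trace_cfc, trace_eq_sum_quad hA (NormedSpace.exp B),
    ← Finset.sum_add_distrib]
  refine Finset.sum_le_sum fun i _ => ?_
  set a := hA.eigenvalues i
  set u := eigVec hA i
  have h1 : u ⬝ᵥ ((B - A) *ᵥ u) = u ⬝ᵥ (B *ᵥ u) - a := by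
    rw [Matrix.sub_mulVec, dotProduct_sub, quad_eigVec]
  -- On a unit eigenvector `u` of `A` with eigenvalue `a`, the left side is the tangent line of
  -- `exp` at `a`, applied to `B` by the calculus of `B`. It remains that `exp` lies above its
  -- tangent.
  have h2 : Real.exp a + Real.exp a * (u ⬝ᵥ ((B - A) *ᵥ u)) =
      u ⬝ᵥ ((hB.cfc fun x => (Real.exp a - Real.exp a * a) * 1 + Real.exp a * x) *ᵥ u) := by
    rw [← cfc_add_cfc, cfc_const_mul hB _ (fun _ => 1), cfc_const_mul hB _ (fun x => x),
      cfc_one_eq, cfc_id_eq, h1, Matrix.add_mulVec, dotProduct_add, Matrix.smul_mulVec,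
      Matrix.smul_mulVec, dotProduct_smul, dotProduct_smul, Matrix.one_mulVec,
      eigVec_dot_self, smul_eq_mul, smul_eq_mul]
    ring
  rw [h2, exp_eq_cfc hB]
  refine quad_cfc_mono hB (fun x => ?_) u
  have h3 : Real.exp x = Real.exp a * Real.exp (x - a) := by rw [← Real.exp_add]; congr 1; ring
  rw [h3]
  nlinarith [Real.add_one_le_exp (x - a), Real.exp_pos a]

/-- Midpoint convexity of the trace exponential. -/
theorem two_mul_trace_exp_le {A B C : Matrix ι ι ℝ} (hA : A.IsHermitian) (hB : B.IsHermitian)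
    (hC : C.IsHermitian) (h : B + C = (2 : ℝ) • A) :
    2 * (NormedSpace.exp A).trace ≤ (NormedSpace.exp B).trace + (NormedSpace.exp C).trace := by
  have h1 := trace_exp_gradient_le hA hB
  have h2 := trace_exp_gradient_le hA hC
  have h3 : (NormedSpace.exp A * (B - A)).trace + (NormedSpace.exp A * (C - A)).trace = 0 := by
    rw [← Matrix.trace_add, ← mul_add, show B - A + (C - A) = 0 by
      rw [show B - A + (C - A) = B + C - (2 : ℝ) • A by rw [two_smul]; abel, h, sub_self],
      mul_zero, Matrix.trace_zero]
  linarith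

/-- Each eigenvalue of a symmetric matrix is controlled by the trace exponential. -/
theorem exp_quad_le_trace_exp {S : Matrix ι ι ℝ} (hS : S.IsHermitian) {s : ℝ}
    (h : (NormedSpace.exp S).trace < Real.exp s) (w : ι → ℝ) :
    w ⬝ᵥ (S *ᵥ w) ≤ s * (w ⬝ᵥ w) := by
  rw [exp_eq_cfc hS, trace_cfc] at h
  have h1 := quad_cfc hS (fun x => x) w
  rw [cfc_id_eq] at h1
  rw [h1, ← sum_eigVec_dot_sq hS w, Finset.mul_sum]
  refine Finset.sum_le_sum fun i _ => mul_le_mul_of_nonneg_right ?_ (sq_nonneg _)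
  have h2 : Real.exp (hS.eigenvalues i) ≤ ∑ j, Real.exp (hS.eigenvalues j) :=
    Finset.single_le_sum (f := fun j => Real.exp (hS.eigenvalues j))
      (fun j _ => (Real.exp_pos _).le) (Finset.mem_univ i)
  exact (Real.exp_lt_exp.mp (h2.trans_lt h)).le

theorem trace_exp_nonneg {S : Matrix ι ι ℝ} (hS : S.IsHermitian) :
    0 ≤ (NormedSpace.exp S).trace := by
  rw [exp_eq_cfc hS, trace_cfc]
  exact Finset.sum_nonneg fun i _ => (Real.exp_pos _).le

end SpectralCalculus

/-! ### The polar part and nuclear norm duality. -/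

section NuclearNorm

theorem cfc_congr_eigenvalues {ι : Type*} [Fintype ι] [DecidableEq ι] {H : Matrix ι ι ℝ}
    (hH : H.IsHermitian) {f g : ℝ → ℝ} (h : ∀ i, f (hH.eigenvalues i) = g (hH.eigenvalues i)) :
    hH.cfc f = hH.cfc g := by
  rw [cfc_eq_eigU, cfc_eq_eigU]
  simp only [h]

variable {d₁ d₂ : ℕ}

theorem dotProduct_mulVec_transpose_mul {ι κ : Type*} [Fintype ι] [Fintype κ]
    (A B : Matrix ι κ ℝ) (w z : κ → ℝ) :
    w ⬝ᵥ ((Aᵀ * B) *ᵥ z) = (A *ᵥ w) ⬝ᵥ (B *ᵥ z) := by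
  rw [← Matrix.mulVec_mulVec, Matrix.dotProduct_mulVec, Matrix.vecMul_transpose]

/-- `A (AᵀA)^{-1/2}`, the partial isometry in the polar decomposition of `A`. -/
noncomputable def polar (A : Matrix (Fin d₁) (Fin d₂) ℝ) : Matrix (Fin d₁) (Fin d₂) ℝ :=
  A * (isHermitian_conjTranspose_mul_self A).cfc fun x => (√x)⁻¹

theorem transpose_mul_self_mul_cfc (A : Matrix (Fin d₁) (Fin d₂) ℝ) (f : ℝ → ℝ) :
    Aᵀ * A * (isHermitian_conjTranspose_mul_self A).cfc f =
      (isHermitian_conjTranspose_mul_self A).cfc fun x => x * f x := by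
  rw [← cfc_mul_cfc _ (fun x => x) f, cfc_id_eq]
  rfl

theorem polar_transpose_mul (A : Matrix (Fin d₁) (Fin d₂) ℝ) :
    (polar A)ᵀ * A = (isHermitian_conjTranspose_mul_self A).cfc fun x => (√x)⁻¹ * x := by
  rw [polar, Matrix.transpose_mul, transpose_cfc, Matrix.mul_assoc, ← cfc_mul_cfc _ _ (fun x => x),
    cfc_id_eq]
  rfl

theorem polar_transpose_mul_polar (A : Matrix (Fin d₁) (Fin d₂) ℝ) :
    (polar A)ᵀ * polar A =
      (isHermitian_conjTranspose_mul_self A).cfc fun x => (√x)⁻¹ * x * (√x)⁻¹ := by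
  rw [← cfc_mul_cfc _ (fun x => (√x)⁻¹ * x), ← polar_transpose_mul, Matrix.mul_assoc]
  rfl

theorem traceInner_polar (A : Matrix (Fin d₁) (Fin d₂) ℝ) :
    traceInner (polar A) A = nuclearNorm A := by
  rw [traceInner, polar_transpose_mul, trace_cfc, nuclearNorm]
  refine Finset.sum_congr rfl fun i _ => ?_
  rw [inv_mul_eq_div, Real.div_sqrt]

/-- Since `√x = 0` for `x ≤ 0` and `0⁻¹ = 0`, the left side is the indicator of `x > 0`. Hence
`(polar A)ᵀ * polar A` is the projection onto the row space of `A`, kernel included. -/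
theorem inv_sqrt_mul_self_mul_inv_sqrt_le (x : ℝ) : (√x)⁻¹ * x * (√x)⁻¹ ≤ 1 := by
  rw [inv_mul_eq_div, Real.div_sqrt]
  exact mul_inv_le_one

theorem polar_contraction (A : Matrix (Fin d₁) (Fin d₂) ℝ) (w : Fin d₂ → ℝ) :
    (polar A *ᵥ w) ⬝ᵥ (polar A *ᵥ w) ≤ w ⬝ᵥ w := by
  rw [← dotProduct_mulVec_transpose_mul, polar_transpose_mul_polar]
  refine (quad_cfc_mono _ inv_sqrt_mul_self_mul_inv_sqrt_le w).trans_eq ?_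
  rw [cfc_one_eq, Matrix.one_mulVec]

theorem polar_mul_transpose_mul_polar (A : Matrix (Fin d₁) (Fin d₂) ℝ) :
    polar A * ((polar A)ᵀ * polar A) = polar A := by
  rw [polar_transpose_mul_polar, polar, Matrix.mul_assoc, cfc_mul_cfc]
  congr 2
  funext x
  rw [show (√x)⁻¹ * x = √x by rw [inv_mul_eq_div, Real.div_sqrt]]
  by_cases h : √x = 0
  · simp [h]
  · rw [mul_inv_cancel₀ h, mul_one]

theorem mul_polar_transpose_mul_polar (A : Matrix (Fin d₁) (Fin d₂) ℝ) :
    A * ((polar A)ᵀ * polar A) = A := by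
  rw [polar_transpose_mul_polar, ← sub_eq_zero]
  set hH := isHermitian_conjTranspose_mul_self A
  have h1 : A * (hH.cfc fun x => (√x)⁻¹ * x * (√x)⁻¹) - A =
      A * hH.cfc (fun x => (√x)⁻¹ * x * (√x)⁻¹ + -1) := by
    rw [← cfc_add_cfc hH _ (fun _ => -1), cfc_neg_eq hH (fun _ => 1), cfc_one_eq, Matrix.mul_add, Matrix.mul_neg,
      Matrix.mul_one, sub_eq_add_neg]
  -- The difference is zero because its Gram matrix is a function of `AᵀA` that vanishes at every
  -- eigenvalue.
  rw [h1, ← Matrix.conjTranspose_mul_self_eq_zero, Matrix.conjTranspose_eq_transpose_of_trivial,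
    Matrix.transpose_mul, transpose_cfc, Matrix.mul_assoc, ← Matrix.mul_assoc Aᵀ,
    transpose_mul_self_mul_cfc, cfc_mul_cfc]
  have h2 : (0 : Matrix (Fin d₂) (Fin d₂) ℝ) = hH.cfc fun _ => 0 := by
    have := cfc_const_mul hH 0 (fun _ => 0)
    simpa using this.symm
  rw [h2]
  refine cfc_congr_eigenvalues hH fun i => ?_
  have h0 : 0 ≤ hH.eigenvalues i := Matrix.eigenvalues_conjTranspose_mul_self_nonneg A i
  set x := hH.eigenvalues i
  rw [inv_mul_eq_div, Real.div_sqrt]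
  rcases h0.eq_or_lt with h | h
  · rw [← h]; simp
  · rw [mul_inv_cancel₀ (Real.sqrt_pos.mpr h).ne']; simp

theorem polar_mul_polar_transpose_mul (A : Matrix (Fin d₁) (Fin d₂) ℝ) :
    polar A * (polar A)ᵀ * A = A := by
  conv_rhs => rw [← mul_polar_transpose_mul_polar A]
  rw [polar_transpose_mul_polar, Matrix.mul_assoc, polar_transpose_mul, polar, Matrix.mul_assoc, cfc_mul_cfc]
  congr 2
  funext x
  ring

theorem mul_polar_eq_zero {A : Matrix (Fin d₁) (Fin d₂) ℝ} {P : Matrix (Fin d₁) (Fin d₁) ℝ}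
    (h : P * A = 0) : P * polar A = 0 := by
  rw [polar, ← Matrix.mul_assoc, h, Matrix.zero_mul]

/-- A factor `A` can be brought to the right end: `A(AᵀA)^{-1/2} = A(AᵀA)^{-3/2}AᵀA`, with inverse
powers read as 0 at 0. -/
theorem polar_mul_eq_zero {A : Matrix (Fin d₁) (Fin d₂) ℝ} {Q : Matrix (Fin d₂) (Fin d₂) ℝ}
    (h : A * Q = 0) : polar A * Q = 0 := by
  have h1 : polar A = A * ((isHermitian_conjTranspose_mul_self A).cfc fun x => (√x)⁻¹ * x⁻¹) *
      (Aᵀ * A) := by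
    have h2 := cfc_mul_cfc (isHermitian_conjTranspose_mul_self A) (fun x => (√x)⁻¹ * x⁻¹)
      (fun x => x)
    rw [cfc_id_eq] at h2
    rw [Matrix.mul_assoc, ← Matrix.conjTranspose_eq_transpose_of_trivial A, h2, polar]
    congr 2
    funext x
    by_cases hx : x = 0
    · simp [hx]
    · rw [mul_assoc, inv_mul_cancel₀ hx, mul_one]
  rw [h1]
  simp only [Matrix.mul_assoc, h, Matrix.mul_zero]

theorem traceInner_self_polar (A : Matrix (Fin d₁) (Fin d₂) ℝ) :
    traceInner (polar A) (polar A) = A.rank := by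
  rw [traceInner, polar_transpose_mul_polar, trace_cfc, ← Matrix.rank_conjTranspose_mul_self,
    (isHermitian_conjTranspose_mul_self A).rank_eq_card_non_zero_eigs, Fintype.card_subtype,
    Finset.card_eq_sum_ones, Finset.sum_filter, Nat.cast_sum]
  refine Finset.sum_congr rfl fun i _ => ?_
  have h0 := Matrix.eigenvalues_conjTranspose_mul_self_nonneg A i
  rw [inv_mul_eq_div, Real.div_sqrt]
  rcases h0.eq_or_lt with h | h
  · rw [← h]; simp
  · rw [mul_inv_cancel₀ (Real.sqrt_pos.mpr h).ne', if_pos h.ne', Nat.cast_one]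

theorem traceInner_eq_sum (A B : Matrix (Fin d₁) (Fin d₂) ℝ) :
    traceInner A B = ∑ i, ∑ j, A i j * B i j := by
  rw [Finset.sum_comm]
  simp [traceInner, Matrix.trace, Matrix.mul_apply]

theorem norm_sq_eq_traceInner (A : Matrix (Fin d₁) (Fin d₂) ℝ) : ‖A‖ ^ 2 = traceInner A A := by
  rw [Matrix.frobenius_norm_def, traceInner_eq_sum, ← Real.sqrt_eq_rpow, Real.sq_sqrt]
  · refine Finset.sum_congr rfl fun i _ => Finset.sum_congr rfl fun j _ => ?_
    rw [Real.rpow_two, Real.norm_eq_abs, sq_abs, pow_two]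
  · positivity

theorem traceInner_le_norm_mul_norm (A B : Matrix (Fin d₁) (Fin d₂) ℝ) :
    traceInner A B ≤ ‖A‖ * ‖B‖ := by
  have h : ∀ C : Matrix (Fin d₁) (Fin d₂) ℝ,
      ‖C‖ = √(∑ p : Fin d₁ × Fin d₂, C p.1 p.2 ^ 2) := fun C => by
    rw [← Real.sqrt_sq (norm_nonneg C), norm_sq_eq_traceInner, traceInner_eq_sum,
      Fintype.sum_prod_type]
    simp only [pow_two]
  rw [traceInner_eq_sum, h, h, ← Fintype.sum_prod_type' (f := fun i j => A i j * B i j)]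
  exact Real.sum_mul_le_sqrt_mul_sqrt _ _ _

theorem norm_polar (A : Matrix (Fin d₁) (Fin d₂) ℝ) : ‖polar A‖ = √(A.rank : ℝ) := by
  rw [← traceInner_self_polar, ← norm_sq_eq_traceInner, Real.sqrt_sq (norm_nonneg _)]

theorem nuclearNorm_nonneg (A : Matrix (Fin d₁) (Fin d₂) ℝ) : 0 ≤ nuclearNorm A :=
  Finset.sum_nonneg fun _ _ => Real.sqrt_nonneg _

theorem nuclearNorm_le_sqrt_rank_mul_norm (A : Matrix (Fin d₁) (Fin d₂) ℝ) :
    nuclearNorm A ≤ √(A.rank : ℝ) * ‖A‖ := by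
  rw [← traceInner_polar, ← norm_polar]
  exact traceInner_le_norm_mul_norm _ _

/-- Duality of the operator norm and the nuclear norm. -/
theorem traceInner_le_mul_nuclearNorm {V : Matrix (Fin d₁) (Fin d₂) ℝ} {c : ℝ} (hc : 0 ≤ c)
    (hV : ∀ w, (V *ᵥ w) ⬝ᵥ (V *ᵥ w) ≤ c ^ 2 * (w ⬝ᵥ w)) (A : Matrix (Fin d₁) (Fin d₂) ℝ) :
    traceInner V A ≤ c * nuclearNorm A := by
  set hH := isHermitian_conjTranspose_mul_self A
  -- The trace is taken in the eigenbasis `u_j` of `AᵀA`: `‖A u_j‖` is a singular value, `‖V u_j‖ ≤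
  -- c`, and Cauchy–Schwarz applies to each term.
  rw [traceInner, trace_eq_sum_quad hH, nuclearNorm, Finset.mul_sum]
  refine Finset.sum_le_sum fun j _ => ?_
  set u := eigVec hH j
  have hA : (A *ᵥ u) ⬝ᵥ (A *ᵥ u) = hH.eigenvalues j := by
    rw [← dotProduct_mulVec_transpose_mul, ← Matrix.conjTranspose_eq_transpose_of_trivial]
    exact quad_eigVec hH j
  have hVu := hV u
  rw [eigVec_dot_self, mul_one] at hVu
  have hcs := Real.sum_mul_le_sqrt_mul_sqrt Finset.univ (V *ᵥ u) (A *ᵥ u)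
  rw [dotProduct_mulVec_transpose_mul]
  refine hcs.trans ?_
  have h1 : ∑ i, (V *ᵥ u) i ^ 2 = (V *ᵥ u) ⬝ᵥ (V *ᵥ u) := by
    simp only [dotProduct, pow_two]
  have h2 : ∑ i, (A *ᵥ u) i ^ 2 = (A *ᵥ u) ⬝ᵥ (A *ᵥ u) := by
    simp only [dotProduct, pow_two]
  rw [h1, h2, hA]
  exact mul_le_mul_of_nonneg_right (Real.sqrt_le_iff.mpr ⟨hc, hVu⟩) (Real.sqrt_nonneg _)

theorem traceInner_add_right (A B C : Matrix (Fin d₁) (Fin d₂) ℝ) :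
    traceInner A (B + C) = traceInner A B + traceInner A C := by
  simp only [traceInner, Matrix.mul_add, Matrix.trace_add]

theorem traceInner_add_left (A B C : Matrix (Fin d₁) (Fin d₂) ℝ) :
    traceInner (A + B) C = traceInner A C + traceInner B C := by
  simp only [traceInner, Matrix.transpose_add, Matrix.add_mul, Matrix.trace_add]

theorem traceInner_comm (A B : Matrix (Fin d₁) (Fin d₂) ℝ) :
    traceInner A B = traceInner B A := by
  rw [traceInner, traceInner, ← Matrix.trace_transpose, Matrix.transpose_mul,
    Matrix.transpose_transpose]

theorem nuclearNorm_add_le (A B : Matrix (Fin d₁) (Fin d₂) ℝ) :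
    nuclearNorm (A + B) ≤ nuclearNorm A + nuclearNorm B := by
  have h : ∀ w, (polar (A + B) *ᵥ w) ⬝ᵥ (polar (A + B) *ᵥ w) ≤ (1 : ℝ) ^ 2 * (w ⬝ᵥ w) :=
    fun w => by simpa using polar_contraction (A + B) w
  rw [← traceInner_polar, traceInner_add_right]
  have h1 := traceInner_le_mul_nuclearNorm zero_le_one h A
  have h2 := traceInner_le_mul_nuclearNorm zero_le_one h B
  linarith

end NuclearNorm

/-! ### Deterministic analysis of the penalized estimator. -/

section Estimator

variable {d₁ d₂ : ℕ}

/-- The component of `D` orthogonal to the row and column spaces of `B`. -/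
noncomputable def perpPart (B D : Matrix (Fin d₁) (Fin d₂) ℝ) : Matrix (Fin d₁) (Fin d₂) ℝ :=
  (1 - polar B * (polar B)ᵀ) * D * (1 - (polar B)ᵀ * polar B)

theorem polar_proj_left (B : Matrix (Fin d₁) (Fin d₂) ℝ) :
    polar B * (polar B)ᵀ * (1 - polar B * (polar B)ᵀ) = 0 := by
  have h := congrArg (· * (polar B)ᵀ) (polar_mul_transpose_mul_polar B)
  simp only [Matrix.mul_assoc] at h
  rw [Matrix.mul_sub, Matrix.mul_one, Matrix.mul_assoc, h, sub_self]

theorem polar_proj_right (B : Matrix (Fin d₁) (Fin d₂) ℝ) :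
    (1 - (polar B)ᵀ * polar B) * ((polar B)ᵀ * polar B) = 0 := by
  rw [Matrix.sub_mul, Matrix.one_mul, Matrix.mul_assoc, polar_mul_transpose_mul_polar, sub_self]

theorem polar_mul_perpPart (B D : Matrix (Fin d₁) (Fin d₂) ℝ) :
    polar B * (polar B)ᵀ * perpPart B D = 0 := by
  rw [perpPart, ← Matrix.mul_assoc, ← Matrix.mul_assoc, polar_proj_left, Matrix.zero_mul, Matrix.zero_mul]

theorem perpPart_mul_polar (B D : Matrix (Fin d₁) (Fin d₂) ℝ) :
    perpPart B D * ((polar B)ᵀ * polar B) = 0 := by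
  rw [perpPart, Matrix.mul_assoc, polar_proj_right, Matrix.mul_zero]

/-- The two partial isometries have orthogonal ranges and orthogonal row spaces. They act on
complementary pieces of `w` and their images are orthogonal, so the squared norms add. -/
theorem polar_add_polar_perpPart_contraction (B D : Matrix (Fin d₁) (Fin d₂) ℝ)
    (w : Fin d₂ → ℝ) :
    ((polar B + polar (perpPart B D)) *ᵥ w) ⬝ᵥ ((polar B + polar (perpPart B D)) *ᵥ w) ≤
      w ⬝ᵥ w := by
  set V := polar B with hV
  set G := polar (perpPart B D)
  have hPG : V * Vᵀ * G = 0 := mul_polar_eq_zero (polar_mul_perpPart B D)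
  have hGQ : G * (Vᵀ * V) = 0 := polar_mul_eq_zero (perpPart_mul_polar B D)
  have hVQ : V * (Vᵀ * V) = V := polar_mul_transpose_mul_polar B
  have hVG : Vᵀ * G = 0 := by
    have h := congrArg Matrix.transpose hVQ
    simp only [Matrix.transpose_mul, Matrix.transpose_transpose] at h
    rw [← h, Matrix.mul_assoc, Matrix.mul_assoc, ← Matrix.mul_assoc V, hPG, Matrix.mul_zero]
  have hcross : (V *ᵥ w) ⬝ᵥ (G *ᵥ w) = 0 := by
    rw [← dotProduct_mulVec_transpose_mul, hVG, Matrix.zero_mulVec, dotProduct_zero]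
  have hG : G *ᵥ w = G *ᵥ ((1 - Vᵀ * V) *ᵥ w) := by
    rw [Matrix.mulVec_mulVec, Matrix.mul_sub, Matrix.mul_one, hGQ, sub_zero]
  have hGw : (G *ᵥ w) ⬝ᵥ (G *ᵥ w) ≤ w ⬝ᵥ ((1 - Vᵀ * V) *ᵥ w) := by
    rw [hG]
    refine (polar_contraction _ _).trans_eq ?_
    rw [← dotProduct_mulVec_transpose_mul]
    congr 2
    rw [Matrix.transpose_sub, Matrix.transpose_one, Matrix.transpose_mul,
      Matrix.transpose_transpose, Matrix.mul_sub, Matrix.mul_one, polar_proj_right, sub_zero]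
  have hVw : (V *ᵥ w) ⬝ᵥ (V *ᵥ w) = w ⬝ᵥ ((Vᵀ * V) *ᵥ w) :=
    (dotProduct_mulVec_transpose_mul V V w w).symm
  rw [Matrix.sub_mulVec, dotProduct_sub, Matrix.one_mulVec, ← hVw] at hGw
  rw [Matrix.add_mulVec, add_dotProduct, dotProduct_add, dotProduct_add,
    dotProduct_comm (G *ᵥ w) (V *ᵥ w), hcross]
  linarith

/-- Decomposability of the nuclear norm. -/
theorem nuclearNorm_add_ge (B D : Matrix (Fin d₁) (Fin d₂) ℝ) :
    nuclearNorm B + nuclearNorm (perpPart B D) - √(B.rank : ℝ) * ‖D‖ ≤ nuclearNorm (B + D) := by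
  have hPB : polar B * (polar B)ᵀ * B = B := polar_mul_polar_transpose_mul B
  have hPG : polar B * (polar B)ᵀ * polar (perpPart B D) = 0 :=
    mul_polar_eq_zero (polar_mul_perpPart B D)
  have hGQ : polar (perpPart B D) * ((polar B)ᵀ * polar B) = 0 :=
    polar_mul_eq_zero (perpPart_mul_polar B D)
  -- The sum `V + G` of the polar parts is a dual certificate: `V` attains the nuclear norm of `B`,
  -- `G` that of the perpendicular part, and `G` does not see `B`. Only `⟨V, D⟩` is lost, and `‖V‖`
  -- is the square root of the rank of `B`.
  have h1 := traceInner_le_mul_nuclearNorm (V := polar B + polar (perpPart B D)) zero_le_one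
    (fun w => by simpa using polar_add_polar_perpPart_contraction B D w) (B + D)
  rw [one_mul, traceInner_add_left, traceInner_add_right, traceInner_add_right,
    traceInner_polar] at h1
  set V := polar B with hV
  set G := polar (perpPart B D) with hG
  have hGP : Gᵀ * (V * Vᵀ) = 0 := by
    have h := congrArg Matrix.transpose hPG
    simpa only [Matrix.transpose_mul, Matrix.transpose_transpose, Matrix.transpose_zero] using h
  have h2 : traceInner G B = 0 := by
    rw [traceInner, ← hPB, ← Matrix.mul_assoc, hGP, Matrix.zero_mul, Matrix.trace_zero]
  have h3 : traceInner G D = nuclearNorm (perpPart B D) := by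
    have hGP1 : Gᵀ * (1 - V * Vᵀ) = Gᵀ := by
      rw [Matrix.mul_sub, Matrix.mul_one, hGP, sub_zero]
    rw [← traceInner_polar, ← hG, traceInner, traceInner, perpPart, ← hV, ← Matrix.mul_assoc,
      ← Matrix.mul_assoc, hGP1, Matrix.mul_sub, Matrix.mul_one, Matrix.trace_sub,
      Matrix.trace_mul_comm _ (Vᵀ * V), ← Matrix.mul_assoc]
    have h := congrArg Matrix.transpose hGQ
    simp only [Matrix.transpose_mul, Matrix.transpose_transpose, Matrix.transpose_zero] at h
    rw [h, Matrix.zero_mul, Matrix.trace_zero, sub_zero]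
  have h4 : -(√(B.rank : ℝ) * ‖D‖) ≤ traceInner V D := by
    have h := traceInner_le_norm_mul_norm V (-D)
    rw [norm_neg, norm_polar] at h
    have h' : traceInner V (-D) = -traceInner V D := by simp [traceInner]
    linarith
  linarith

theorem norm_contraction_mul_le {P : Matrix (Fin d₁) (Fin d₁) ℝ} (hPt : Pᵀ = P) (hPP : P * P = P)
    (A : Matrix (Fin d₁) (Fin d₂) ℝ) : ‖P * A‖ ≤ ‖A‖ := by
  have h : ‖A‖ ^ 2 = ‖P * A‖ ^ 2 + ‖(1 - P) * A‖ ^ 2 := by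
    simp only [norm_sq_eq_traceInner, traceInner, Matrix.transpose_mul, Matrix.transpose_sub,
      Matrix.transpose_one, hPt]
    rw [← Matrix.trace_add]
    congr 1
    have h1 : P * (P * A) = P * A := by rw [← Matrix.mul_assoc, hPP]
    simp only [Matrix.mul_assoc, Matrix.sub_mul, Matrix.mul_sub, Matrix.one_mul, h1]
    abel
  refine le_of_sq_le_sq ?_ (norm_nonneg _)
  nlinarith [sq_nonneg ‖(1 - P) * A‖]

theorem norm_mul_contraction_le {Q : Matrix (Fin d₂) (Fin d₂) ℝ} (hQt : Qᵀ = Q) (hQQ : Q * Q = Q)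
    (A : Matrix (Fin d₁) (Fin d₂) ℝ) : ‖A * Q‖ ≤ ‖A‖ := by
  have h := norm_contraction_mul_le hQt hQQ Aᵀ
  rw [← Matrix.frobenius_norm_transpose (A * Q), Matrix.transpose_mul, hQt]
  exact h.trans_eq (Matrix.frobenius_norm_transpose A)

theorem rank_polar_le (B : Matrix (Fin d₁) (Fin d₂) ℝ) : (polar B).rank ≤ B.rank :=
  Matrix.rank_mul_le_left _ _

/-- With `P` and `Q` the column and row projections of `B`, the difference is `PD + (1-P)DQ`. Each
term has rank at most that of `B` and Frobenius norm at most `‖D‖`. -/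
theorem nuclearNorm_sub_perpPart_le (B D : Matrix (Fin d₁) (Fin d₂) ℝ) :
    nuclearNorm (D - perpPart B D) ≤ 2 * √(B.rank : ℝ) * ‖D‖ := by
  set V := polar B with hV
  set P := V * Vᵀ with hP
  set Q := Vᵀ * V with hQ
  have hPt : Pᵀ = P := by simp [hP]
  have hQt : Qᵀ = Q := by simp [hQ]
  have hPP : P * P = P := by
    have h := polar_proj_left B
    rw [Matrix.mul_sub, Matrix.mul_one, sub_eq_zero] at h
    exact h.symm
  have hQQ : Q * Q = Q := by
    have h := polar_proj_right B
    rw [Matrix.sub_mul, Matrix.one_mul, sub_eq_zero] at h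
    exact h.symm
  have hPt' : (1 - P)ᵀ = 1 - P := by rw [Matrix.transpose_sub, Matrix.transpose_one, hPt]
  have hPP' : (1 - P) * (1 - P) = 1 - P := by
    simp only [Matrix.mul_sub, Matrix.sub_mul, Matrix.one_mul, Matrix.mul_one, hPP]; abel
  have hdec : D - perpPart B D = P * D + (1 - P) * D * Q := by
    rw [perpPart, ← hV, ← hP, ← hQ]
    simp only [Matrix.sub_mul, Matrix.mul_sub, Matrix.one_mul, Matrix.mul_one]
    abel
  have hr1 : (P * D).rank ≤ B.rank :=
    (Matrix.rank_mul_le_left _ _).trans ((Matrix.rank_mul_le_left _ _).trans (rank_polar_le B))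
  have hr2 : ((1 - P) * D * Q).rank ≤ B.rank :=
    (Matrix.rank_mul_le_right _ _).trans ((Matrix.rank_mul_le_right _ _).trans (rank_polar_le B))
  have h1 : nuclearNorm (P * D) ≤ √(B.rank : ℝ) * ‖D‖ :=
    (nuclearNorm_le_sqrt_rank_mul_norm _).trans
      (mul_le_mul (Real.sqrt_le_sqrt (by exact_mod_cast hr1)) (norm_contraction_mul_le hPt hPP D)
        (norm_nonneg _) (Real.sqrt_nonneg _))
  have h2 : nuclearNorm ((1 - P) * D * Q) ≤ √(B.rank : ℝ) * ‖D‖ :=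
    (nuclearNorm_le_sqrt_rank_mul_norm _).trans
      (mul_le_mul (Real.sqrt_le_sqrt (by exact_mod_cast hr2))
        ((norm_mul_contraction_le hQt hQQ _).trans (norm_contraction_mul_le hPt' hPP' D))
        (norm_nonneg _) (Real.sqrt_nonneg _))
  rw [hdec]
  linarith [nuclearNorm_add_le (P * D) ((1 - P) * D * Q)]

/-- Error bounds for nuclear-norm penalized least squares when the operator norm of the noise
matrix is at most a quarter of the regularization parameter. -/
theorem penalized_error_bound {B W β : Matrix (Fin d₁) (Fin d₂) ℝ} {lam : ℝ} (hlam : 0 ≤ lam)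
    (hW : ∀ w, (W *ᵥ w) ⬝ᵥ (W *ᵥ w) ≤ (lam / 4) ^ 2 * (w ⬝ᵥ w))
    (hβ : traceInner β β - 2 * traceInner (B + W) β + lam * nuclearNorm β ≤
      traceInner B B - 2 * traceInner (B + W) B + lam * nuclearNorm B) :
    ‖β - B‖ ≤ 2 * √(B.rank : ℝ) * lam ∧ nuclearNorm (β - B) ≤ 6 * B.rank * lam := by
  obtain ⟨D, rfl⟩ : ∃ D, β = B + D := ⟨β - B, by abel⟩
  rw [add_sub_cancel_left]
  have h1 := nuclearNorm_add_ge B D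
  have h2 := nuclearNorm_sub_perpPart_le B D
  have hW1 := traceInner_le_mul_nuclearNorm (by positivity) hW (D - perpPart B D)
  have hW2 := traceInner_le_mul_nuclearNorm (by positivity) hW (perpPart B D)
  have hWD : traceInner W D = traceInner W (D - perpPart B D) + traceInner W (perpPart B D) := by
    rw [← traceInner_add_right, sub_add_cancel]
  have hN : nuclearNorm D ≤ nuclearNorm (D - perpPart B D) + nuclearNorm (perpPart B D) := by
    have h := nuclearNorm_add_le (D - perpPart B D) (perpPart B D)
    rwa [sub_add_cancel] at h
  simp only [traceInner_add_left, traceInner_add_right, traceInner_comm D B] at hβ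
  rw [← norm_sq_eq_traceInner D] at hβ
  set x := ‖D‖
  set s := √(B.rank : ℝ)
  set N := nuclearNorm (perpPart B D)
  set K := nuclearNorm (D - perpPart B D)
  have hs2 : s ^ 2 = B.rank := Real.sq_sqrt (Nat.cast_nonneg _)
  have hs : 0 ≤ s := Real.sqrt_nonneg _
  have hx : 0 ≤ x := norm_nonneg _
  have hNn : 0 ≤ N := nuclearNorm_nonneg _
  have hpen : lam * (N - s * x) ≤ lam * (nuclearNorm (B + D) - nuclearNorm B) :=
    mul_le_mul_of_nonneg_left (by linarith) hlam
  have hK : lam * K ≤ lam * (2 * s * x) := mul_le_mul_of_nonneg_left h2 hlam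
  -- The noise contributes at most `(λ/2)(K + N)` and the penalty recovers `λ(N - s x)`. As `K ≤ 2 s
  -- x`, half of `λN` survives on the left.
  have hmain : x ^ 2 + lam / 2 * N ≤ 2 * (s * lam) * x := by nlinarith
  have hxb : x ≤ 2 * s * lam := by
    by_contra hcon
    push Not at hcon
    have hlN : 0 ≤ lam / 2 * N := by positivity
    have : 0 ≤ s * lam := by positivity
    nlinarith
  refine ⟨hxb, ?_⟩
  rw [← hs2]
  have hKb : K ≤ 4 * s ^ 2 * lam := by
    have := mul_le_mul_of_nonneg_left hxb (show 0 ≤ 2 * s by positivity)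
    nlinarith
  -- The bound on `N` divides by `λ`; when `λ = 0` the Frobenius bound already forces `D = 0`.
  rcases hlam.eq_or_lt with h0 | h0
  · have hx0 : x = 0 := by
      have : 2 * s * lam = 0 := by rw [← h0, mul_zero]
      linarith
    have hD : D = 0 := norm_eq_zero.mp hx0
    have hzero : nuclearNorm (0 : Matrix (Fin d₁) (Fin d₂) ℝ) ≤ 0 := by
      have h := nuclearNorm_le_sqrt_rank_mul_norm (0 : Matrix (Fin d₁) (Fin d₂) ℝ)
      simpa using h
    rw [hD]
    have : 0 ≤ 6 * s ^ 2 * lam := by positivity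
    linarith
  · have hNb : N ≤ 2 * s ^ 2 * lam := by
      have h5 : lam / 2 * N ≤ lam / 2 * (2 * s ^ 2 * lam) := by
        nlinarith [sq_nonneg (x - s * lam)]
      exact le_of_mul_le_mul_left h5 (by positivity)
    linarith

end Estimator

/-! ### Scalar inequalities for influence functions. -/

section Influence

variable {φ : ℝ → ℝ}

theorem IsInfluence.exp_le (hφ : IsInfluence φ) (x : ℝ) :
    Real.exp (φ x) ≤ 1 + x + x ^ 2 / 2 := by
  have hpos : 0 < 1 + x + x ^ 2 / 2 := by nlinarith [sq_nonneg (x + 1)]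
  rw [← Real.exp_log hpos]
  exact Real.exp_le_exp.mpr (hφ.2 x).2

theorem IsInfluence.exp_neg_le (hφ : IsInfluence φ) (x : ℝ) :
    Real.exp (-φ x) ≤ 1 - x + x ^ 2 / 2 := by
  have hpos : 0 < 1 - x + x ^ 2 / 2 := by nlinarith [sq_nonneg (x - 1)]
  rw [← Real.exp_log hpos]
  exact Real.exp_le_exp.mpr (by linarith [(hφ.2 x).1])

theorem IsInfluence.le (hφ : IsInfluence φ) (x : ℝ) : φ x ≤ x + x ^ 2 / 2 := by
  linarith [hφ.exp_le x, Real.add_one_le_exp (φ x)]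

theorem IsInfluence.neg_le (hφ : IsInfluence φ) (x : ℝ) : -φ x ≤ -x + x ^ 2 / 2 := by
  linarith [hφ.exp_neg_le x, Real.add_one_le_exp (-φ x)]

theorem IsInfluence.exp_add_exp_neg_le (hφ : IsInfluence φ) (x : ℝ) :
    Real.exp (φ x) + Real.exp (-φ x) ≤ 2 + x ^ 2 := by
  linarith [hφ.exp_le x, hφ.exp_neg_le x]

theorem two_add_sq_le_exp_add_exp_neg (t : ℝ) : 2 + t ^ 2 ≤ Real.exp t + Real.exp (-t) := by
  have h1 : Real.exp t + Real.exp (-t) = 2 * Real.cosh (2 * (t / 2)) := by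
    rw [show 2 * (t / 2) = t by ring, Real.cosh_eq]; ring
  have h2 : (t / 2) ^ 2 ≤ Real.sinh (t / 2) ^ 2 := by
    rcases le_total 0 (t / 2) with h | h
    · have := Real.self_le_sinh_iff.mpr h
      nlinarith
    · have := Real.sinh_le_self_iff.mpr h
      nlinarith
  rw [h1, Real.cosh_two_mul, Real.cosh_sq]
  nlinarith

/-- Both sides are compared with `2 cosh φ(x)`, since `2 + t² ≤ 2 cosh t`. With `φ` possibly
unbounded, this is what makes the entries of the truncated matrices integrable. -/
theorem IsInfluence.sq_le (hφ : IsInfluence φ) (x : ℝ) : φ x * φ x ≤ x ^ 2 := by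
  linarith [hφ.exp_add_exp_neg_le x, two_add_sq_le_exp_add_exp_neg (φ x)]

end Influence

/-! ### Measurability of the functional calculus. -/

section Measurability

open Filter Topology

variable {ι α : Type*} [Fintype ι] [MeasurableSpace α] {H : α → Matrix ι ι ℝ}

theorem measurable_matrix_mul_apply {A B : α → Matrix ι ι ℝ} (hA : ∀ i j, Measurable fun z => A z i j)
    (hB : ∀ i j, Measurable fun z => B z i j) (i j : ι) : Measurable fun z => (A z * B z) i j := by
  simp only [Matrix.mul_apply]
  exact Finset.measurable_sum _ fun k _ => (hA i k).mul (hB k j)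

variable [DecidableEq ι]

theorem cfc_apply_eq_sum {A : Matrix ι ι ℝ} (hA : A.IsHermitian) (f : ℝ → ℝ) (i j : ι) :
    hA.cfc f i j = ∑ k, eigU hA i k * f (hA.eigenvalues k) * eigU hA j k := by
  rw [cfc_eq_eigU, Matrix.mul_apply]
  simp only [Matrix.mul_diagonal, Matrix.transpose_apply]

theorem tendsto_cfc_apply {A : Matrix ι ι ℝ} (hA : A.IsHermitian) {F : ℕ → ℝ → ℝ} {f : ℝ → ℝ}
    (hF : ∀ x, Tendsto (fun n => F n x) atTop (𝓝 (f x))) (i j : ι) :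
    Tendsto (fun n => hA.cfc (F n) i j) atTop (𝓝 (hA.cfc f i j)) := by
  simp only [cfc_apply_eq_sum]
  exact tendsto_finsetSum _ fun k _ => ((hF _).const_mul _).mul_const _

/-- Pointwise convergence suffices because each entry is a finite sum over eigenvalues. Limits of
polynomials thereby avoid any measurable choice of eigenvectors. -/
theorem measurable_cfc_of_tendsto (hH : ∀ z, (H z).IsHermitian) {F : ℕ → ℝ → ℝ} {f : ℝ → ℝ}
    (hFm : ∀ n i j, Measurable fun z => (hH z).cfc (F n) i j)
    (hF : ∀ x, Tendsto (fun n => F n x) atTop (𝓝 (f x))) (i j : ι) :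
    Measurable fun z => (hH z).cfc f i j :=
  measurable_of_tendsto_metrizable (fun n => hFm n i j)
    (tendsto_pi_nhds.mpr fun z => tendsto_cfc_apply (hH z) hF i j)

theorem measurable_cfc_add (hH : ∀ z, (H z).IsHermitian) {f g : ℝ → ℝ}
    (hf : ∀ i j, Measurable fun z => (hH z).cfc f i j)
    (hg : ∀ i j, Measurable fun z => (hH z).cfc g i j) (i j : ι) :
    Measurable fun z => (hH z).cfc (fun x => f x + g x) i j := by
  simp only [← cfc_add_cfc, Matrix.add_apply]
  exact (hf i j).add (hg i j)

theorem measurable_cfc_const_mul (hH : ∀ z, (H z).IsHermitian) (c : ℝ) {f : ℝ → ℝ}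
    (hf : ∀ i j, Measurable fun z => (hH z).cfc f i j) (i j : ι) :
    Measurable fun z => (hH z).cfc (fun x => c * f x) i j := by
  simp only [cfc_const_mul, Matrix.smul_apply, smul_eq_mul]
  exact (hf i j).const_mul c

theorem measurable_cfc_polynomial (hH : ∀ z, (H z).IsHermitian)
    (hm : ∀ i j, Measurable fun z => H z i j) (p : Polynomial ℝ) (i j : ι) :
    Measurable fun z => (hH z).cfc (fun x => p.eval x) i j := by
  induction p using Polynomial.induction_on' generalizing i j with
  | add p q hp hq =>
    simp only [Polynomial.eval_add]
    exact measurable_cfc_add hH hp hq i j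
  | monomial n c =>
    simp only [Polynomial.eval_monomial]
    refine measurable_cfc_const_mul hH c (fun i j => ?_) i j
    induction n generalizing i j with
    | zero => simp only [pow_zero, cfc_one_eq]; exact measurable_const
    | succ n ih =>
      simp only [pow_succ, ← cfc_mul_cfc _ (fun x => x ^ n) (fun x => x), cfc_id_eq]
      exact measurable_matrix_mul_apply ih hm i j

theorem measurable_cfc_continuous (hH : ∀ z, (H z).IsHermitian)
    (hm : ∀ i j, Measurable fun z => H z i j) {f : ℝ → ℝ} (hf : Continuous f) (i j : ι) :
    Measurable fun z => (hH z).cfc f i j := by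
  have hp : ∀ n : ℕ, ∃ p : Polynomial ℝ, ∀ x ∈ Set.Icc (-(n : ℝ)) n,
      |p.eval x - f x| < 1 / ((n : ℝ) + 1) := fun n =>
    exists_polynomial_near_of_continuousOn _ _ f hf.continuousOn _ (by positivity)
  choose p hp using hp
  refine measurable_cfc_of_tendsto hH (F := fun n x => (p n).eval x)
    (fun n => measurable_cfc_polynomial hH hm (p n)) (fun x => ?_) i j
  rw [tendsto_iff_dist_tendsto_zero]
  refine squeeze_zero' (Eventually.of_forall fun _ => dist_nonneg) ?_
    tendsto_one_div_add_atTop_nhds_zero_nat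
  filter_upwards [eventually_ge_atTop ⌈|x|⌉₊] with n hn
  have h := Nat.ceil_le.mp hn
  exact (hp n x (abs_le.mp h)).le

theorem measurable_cfc_indicator (hH : ∀ z, (H z).IsHermitian)
    (hm : ∀ i j, Measurable fun z => H z i j) {s : Set ℝ} (hs : MeasurableSet s) :
    ∀ i j, Measurable fun z => (hH z).cfc (s.indicator fun _ => 1) i j := by
  have hcompl : ∀ t : Set ℝ, (∀ i j, Measurable fun z => (hH z).cfc (t.indicator fun _ => 1) i j) →
      ∀ i j, Measurable fun z => (hH z).cfc (tᶜ.indicator fun _ => 1) i j := by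
    intro t ht i j
    have h : (tᶜ.indicator fun _ => (1 : ℝ)) = fun x => 1 + (-1) * t.indicator (fun _ => 1) x := by
      funext x
      by_cases hx : x ∈ t <;> simp [hx]
    rw [h]
    exact measurable_cfc_add hH (fun i j => measurable_cfc_continuous hH hm continuous_const i j)
      (measurable_cfc_const_mul hH (-1) ht) i j
  induction s, hs using MeasurableSet.induction_on_open with
  | isOpen U hU =>
    rw [← compl_compl U]
    refine hcompl _ fun i j => ?_
    have hδ : ∀ n : ℕ, 0 < 1 / ((n : ℝ) + 1) := fun n => by positivity
    refine measurable_cfc_of_tendsto hH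
      (F := fun n x => (thickenedIndicator (hδ n) Uᶜ x : ℝ))
      (fun n => measurable_cfc_continuous hH hm
        (NNReal.continuous_coe.comp (thickenedIndicator (hδ n) Uᶜ).continuous)) (fun x => ?_) i j
    have h := thickenedIndicator_tendsto_indicator_closure
      (δseq := fun n : ℕ => 1 / ((n : ℝ) + 1)) hδ
      tendsto_one_div_add_atTop_nhds_zero_nat Uᶜ
    rw [hU.isClosed_compl.closure_eq, tendsto_pi_nhds] at h
    have h2 := (NNReal.continuous_coe.tendsto _).comp (h x)
    convert! h2 using 2
    by_cases hx : x ∈ U <;> simp [hx]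
  | compl t _ ih => exact hcompl t ih
  | iUnion g hd _ ih =>
    intro i j
    refine measurable_cfc_of_tendsto hH
      (F := fun n x => ∑ k ∈ Finset.range n, (g k).indicator (fun _ => (1 : ℝ)) x) (fun n => ?_)
      (fun x => ?_) i j
    · induction n with
      | zero =>
        simp only [Finset.range_zero, Finset.sum_empty]
        exact fun i j => measurable_cfc_continuous hH hm continuous_const i j
      | succ n ihn =>
        simp only [Finset.sum_range_succ]
        exact measurable_cfc_add hH ihn (ih n)
    · by_cases hx : x ∈ ⋃ k, g k
      · obtain ⟨k, hk⟩ := Set.mem_iUnion.mp hx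
        rw [Set.indicator_of_mem hx]
        refine tendsto_const_nhds.congr' ?_
        filter_upwards [eventually_gt_atTop k] with n hn
        rw [Finset.sum_eq_single_of_mem k (Finset.mem_range.mpr hn), Set.indicator_of_mem hk]
        intro l _ hl
        exact Set.indicator_of_notMem (fun hxl => (Set.disjoint_left.mp (hd hl) hxl) hk) _
      · rw [Set.indicator_of_notMem hx]
        refine tendsto_const_nhds.congr fun n => ?_
        refine (Finset.sum_eq_zero fun k _ => Set.indicator_of_notMem (fun hk => hx ?_) _).symm
        exact Set.mem_iUnion.mpr ⟨k, hk⟩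

/-- The Borel functional calculus of a measurable field of symmetric matrices is measurable. -/
theorem measurable_cfc (hH : ∀ z, (H z).IsHermitian)
    (hm : ∀ i j, Measurable fun z => H z i j) {f : ℝ → ℝ} (hf : Measurable f) (i j : ι) :
    Measurable fun z => (hH z).cfc f i j := by
  -- A monotone `φ` may jump, so continuous functions are not enough: the chain goes on through
  -- indicators of Borel sets to simple functions and their limits.
  refine measurable_cfc_of_tendsto hH (F := fun n x => hf.stronglyMeasurable.approx n x)
    (fun n => ?_) (fun x => hf.stronglyMeasurable.tendsto_approx x) i j
  generalize hf.stronglyMeasurable.approx n = s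
  induction s using SimpleFunc.induction with
  | const c hs =>
    rename_i s
    intro i j
    have h : (fun x => (SimpleFunc.piecewise s hs (SimpleFunc.const ℝ c) (SimpleFunc.const ℝ 0)) x) =
        fun x => c * s.indicator (fun _ => 1) x := by
      funext x
      by_cases hx : x ∈ s <;> simp [hx]
    rw [h]
    exact measurable_cfc_const_mul hH c (measurable_cfc_indicator hH hm hs) i j
  | add _ hf hg => exact measurable_cfc_add hH hf hg

end Measurability

/-! ### A matrix Chernoff bound by centering. -/

section Concentration

theorem sum_isHermitian {ι : Type*} {n : ℕ} {F : Fin n → Matrix ι ι ℝ} (hF : ∀ i, (F i).IsHermitian) :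
    (∑ i, F i).IsHermitian := by
  refine isHermitian_of_transpose_eq ?_
  rw [Matrix.transpose_sum]
  exact Finset.sum_congr rfl fun i _ => transpose_eq_of_isHermitian (hF i)

variable {ι α : Type*} [Fintype ι] [MeasurableSpace α] {μ : Measure α}

/-- The entrywise expectation of a random matrix. -/
noncomputable def meanMatrix {ι α : Type*} [MeasurableSpace α] (μ : Measure α)
    (F : α → Matrix ι ι ℝ) : Matrix ι ι ℝ :=
  Matrix.of fun i j => ∫ z, F z i j ∂μ

theorem transpose_meanMatrix {ι α : Type*} [MeasurableSpace α] (μ : Measure α)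
    {F : α → Matrix ι ι ℝ} (hF : ∀ z, (F z)ᵀ = F z) : (meanMatrix μ F)ᵀ = meanMatrix μ F := by
  ext i j
  simp only [meanMatrix, Matrix.transpose_apply, Matrix.of_apply]
  exact integral_congr_ae (Filter.Eventually.of_forall fun z => congrFun (congrFun (hF z) i) j)

theorem measurable_trace_exp [DecidableEq ι] {F : α → Matrix ι ι ℝ} (hF : ∀ i j, Measurable fun z => F z i j) :
    Measurable fun z => (NormedSpace.exp (F z)).trace := by
  let _ : NormedAlgebra ℚ (Matrix ι ι ℝ) := NormedAlgebra.restrictScalars ℚ ℝ _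
  have hc : Continuous fun A : Matrix ι ι ℝ => (NormedSpace.exp A).trace :=
    NormedSpace.exp_continuous.matrix_trace
  have hc' : Continuous fun A : ι → ι → ℝ => (NormedSpace.exp (Matrix.of A)).trace := hc
  exact hc'.measurable.comp (measurable_pi_iff.mpr fun i => measurable_pi_iff.mpr fun j => hF i j)

theorem trace_mul_eq_sum {ι : Type*} [Fintype ι] (K A : Matrix ι ι ℝ) :
    (K * A).trace = ∑ i, ∑ j, K i j * A j i := by
  simp only [Matrix.trace, Matrix.diag, Matrix.mul_apply]

theorem integrable_trace_mul {F : α → Matrix ι ι ℝ}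
    (hF : ∀ i j, Integrable (fun z => F z i j) μ) (K : Matrix ι ι ℝ) :
    Integrable (fun z => (K * F z).trace) μ := by
  simp only [trace_mul_eq_sum]
  exact integrable_finsetSum _ fun i _ => integrable_finsetSum _ fun j _ => (hF j i).const_mul _

theorem integral_trace_mul {F : α → Matrix ι ι ℝ}
    (hF : ∀ i j, Integrable (fun z => F z i j) μ) (K : Matrix ι ι ℝ) :
    ∫ z, (K * F z).trace ∂μ = (K * meanMatrix μ F).trace := by
  have h : ∀ i j, Integrable (fun z => K i j * F z j i) μ := fun i j => (hF j i).const_mul _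
  simp only [trace_mul_eq_sum]
  rw [integral_finsetSum _ fun i _ => integrable_finsetSum _ fun j _ => h i j]
  refine Finset.sum_congr rfl fun i _ => ?_
  rw [integral_finsetSum _ fun j _ => h i j]
  exact Finset.sum_congr rfl fun j _ => integral_const_mul _ _

theorem quad_eq_trace_mul {ι : Type*} [Fintype ι] (A : Matrix ι ι ℝ) (w : ι → ℝ) :
    w ⬝ᵥ (A *ᵥ w) = (Matrix.of (fun i j => w i * w j) * A).trace := by
  simp only [trace_mul_eq_sum, dotProduct, Matrix.mulVec, Matrix.of_apply, Finset.mul_sum]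
  rw [Finset.sum_comm]
  exact Finset.sum_congr rfl fun i _ => Finset.sum_congr rfl fun j _ => by ring

theorem quad_meanMatrix {F : α → Matrix ι ι ℝ} (hF : ∀ i j, Integrable (fun z => F z i j) μ)
    (w : ι → ℝ) : w ⬝ᵥ (meanMatrix μ F *ᵥ w) = ∫ z, w ⬝ᵥ (F z *ᵥ w) ∂μ := by
  simp only [quad_eq_trace_mul]
  exact (integral_trace_mul hF _).symm

theorem integrable_quad {F : α → Matrix ι ι ℝ} (hF : ∀ i j, Integrable (fun z => F z i j) μ)
    (w : ι → ℝ) : Integrable (fun z => w ⬝ᵥ (F z *ᵥ w)) μ := by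
  simp only [quad_eq_trace_mul]
  exact integrable_trace_mul hF _

variable [DecidableEq ι]

/-- `S + (Φ - B)/2` is the midpoint of `S + Φ` and `S - B`. The gradient inequality at `S - B`
towards `S - Φ` exchanges the second endpoint for `S - Φ` plus a term linear in `Φ - B`;
Golden–Thompson then handles `S ± Φ` together. -/
theorem trace_exp_centered_le {S Φ B R : Matrix ι ι ℝ} (hS : S.IsHermitian) (hΦ : Φ.IsHermitian)
    (hB : B.IsHermitian)
    (hR : ∀ w, w ⬝ᵥ ((NormedSpace.exp Φ + NormedSpace.exp (-Φ)) *ᵥ w) ≤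
      w ⬝ᵥ (((2 : ℝ) • (1 : Matrix ι ι ℝ) + R) *ᵥ w)) :
    (NormedSpace.exp (S + (1 / 2 : ℝ) • (Φ - B))).trace ≤
      (NormedSpace.exp S).trace + 1 / 2 * (NormedSpace.exp S * R).trace +
        1 / 2 * ((NormedSpace.exp (S - B) * Φ).trace - (NormedSpace.exp (S - B) * B).trace) := by
  have hmid : (S + (1 / 2 : ℝ) • (Φ - B)).IsHermitian :=
    hS.add (isHermitian_of_transpose_eq (by
      rw [Matrix.transpose_smul, Matrix.transpose_sub, transpose_eq_of_isHermitian hΦ,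
        transpose_eq_of_isHermitian hB]))
  have h1 := two_mul_trace_exp_le hmid (hS.add hΦ) (hS.sub hB) (by module)
  have h2 := trace_exp_gradient_le (hS.sub hB) (hS.add hΦ.neg)
  have h3 := trace_exp_add_le (transpose_eq_of_isHermitian hS) (transpose_eq_of_isHermitian hΦ)
  have h4 := trace_exp_add_le (transpose_eq_of_isHermitian hS) (transpose_eq_of_isHermitian hΦ.neg)
  have h5 := trace_exp_mul_le hS hR
  rw [mul_add, mul_add, Matrix.trace_add, Matrix.trace_add, mul_smul_comm, mul_one,
    Matrix.trace_smul, smul_eq_mul] at h5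
  have h6 : (S + -Φ - (S - B)) = B - Φ := by abel
  rw [h6, mul_sub, Matrix.trace_sub] at h2
  linarith

/-- With `B` the mean of `Φ`, the linear term integrates to zero. Using `∫⁻` makes integrability of
the trace exponential unnecessary. -/
theorem lintegral_trace_exp_centered_le [IsProbabilityMeasure μ] {Φ R : α → Matrix ι ι ℝ}
    {ρ : ℝ} (hΦ : ∀ z, (Φ z).IsHermitian)
    (hΦi : ∀ i j, Integrable (fun z => Φ z i j) μ) (hRi : ∀ i j, Integrable (fun z => R z i j) μ)
    (hR : ∀ z w, w ⬝ᵥ ((NormedSpace.exp (Φ z) + NormedSpace.exp (-Φ z)) *ᵥ w) ≤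
      w ⬝ᵥ (((2 : ℝ) • (1 : Matrix ι ι ℝ) + R z) *ᵥ w))
    (hρ : ∀ w, ∫ z, w ⬝ᵥ (R z *ᵥ w) ∂μ ≤ 2 * ρ * (w ⬝ᵥ w))
    {S : Matrix ι ι ℝ} (hS : S.IsHermitian) :
    ∫⁻ z, ENNReal.ofReal
        (NormedSpace.exp (S + (1 / 2 : ℝ) • (Φ z - meanMatrix μ Φ))).trace ∂μ ≤
      ENNReal.ofReal ((1 + ρ) * (NormedSpace.exp S).trace) := by
  have hB : (meanMatrix μ Φ).IsHermitian := isHermitian_of_transpose_eq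
    (transpose_meanMatrix μ fun z => transpose_eq_of_isHermitian (hΦ z))
  have hpt := fun z => trace_exp_centered_le hS (hΦ z) hB (hR z)
  set B := meanMatrix μ Φ
  set K := NormedSpace.exp (S - B)
  have hmid : ∀ z, (S + (1 / 2 : ℝ) • (Φ z - B)).IsHermitian := fun z =>
    hS.add (isHermitian_of_transpose_eq (by
      rw [Matrix.transpose_smul, Matrix.transpose_sub, transpose_eq_of_isHermitian (hΦ z),
        transpose_eq_of_isHermitian hB]))
  have i1 : Integrable (fun z => 1 / 2 * (NormedSpace.exp S * R z).trace) μ :=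
    (integrable_trace_mul hRi (NormedSpace.exp S)).const_mul (1 / 2)
  have i2 : Integrable (fun z => 1 / 2 * ((K * Φ z).trace - (K * B).trace)) μ := ((integrable_trace_mul hΦi K).sub
    (integrable_const (K * B).trace)).const_mul (1 / 2)
  have i0 := integrable_const (μ := μ) (NormedSpace.exp S).trace
  have i01 : Integrable (fun z => (NormedSpace.exp S).trace +
      1 / 2 * (NormedSpace.exp S * R z).trace) μ := i0.add i1
  have i012 : Integrable (fun z => (NormedSpace.exp S).trace +
      1 / 2 * (NormedSpace.exp S * R z).trace + 1 / 2 * ((K * Φ z).trace - (K * B).trace)) μ :=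
    i01.add i2
  have hmean : (NormedSpace.exp S * meanMatrix μ R).trace ≤
      2 * ρ * (NormedSpace.exp S).trace := by
    refine (trace_exp_mul_le hS (B := (2 * ρ) • 1) fun w => ?_).trans_eq ?_
    · rw [quad_meanMatrix hRi, Matrix.smul_mulVec, Matrix.one_mulVec, dotProduct_smul, smul_eq_mul]
      exact hρ w
    · rw [mul_smul_comm, mul_one, Matrix.trace_smul, smul_eq_mul]
  refine (lintegral_mono fun z => ENNReal.ofReal_le_ofReal (hpt z)).trans ?_
  rw [← ofReal_integral_eq_lintegral_ofReal i012
    (Filter.Eventually.of_forall fun z => (trace_exp_nonneg (hmid z)).trans (hpt z))]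
  refine ENNReal.ofReal_le_ofReal ?_
  have e1 : ∫ z, (NormedSpace.exp S).trace + 1 / 2 * (NormedSpace.exp S * R z).trace +
      1 / 2 * ((K * Φ z).trace - (K * B).trace) ∂μ =
      (NormedSpace.exp S).trace + 1 / 2 * (NormedSpace.exp S * meanMatrix μ R).trace := by
    rw [integral_add i01 i2, integral_add i0 i1, integral_const_mul, integral_const_mul,
      integral_sub (integrable_trace_mul hΦi K) (integrable_const _), integral_trace_mul hRi,
      integral_trace_mul hΦi]
    simp [B]
  refine e1.trans_le ?_
  linarith

/-- Coordinate 0 is split off by independence: the induction hypothesis is used with base `S + G x`,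
then `hstep` integrates out `x`. The free base matrix lets the induction close. -/
theorem lintegral_trace_exp_sum_le [IsProbabilityMeasure μ] {G : α → Matrix ι ι ℝ}
    (hG : ∀ z, (G z).IsHermitian) (hGm : ∀ i j, Measurable fun z => G z i j) {c : ℝ} (hc : 0 ≤ c)
    (hstep : ∀ S : Matrix ι ι ℝ, S.IsHermitian →
      ∫⁻ z, ENNReal.ofReal (NormedSpace.exp (S + G z)).trace ∂μ ≤
        ENNReal.ofReal (c * (NormedSpace.exp S).trace))
    (n : ℕ) {S : Matrix ι ι ℝ} (hS : S.IsHermitian) :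
    ∫⁻ z, ENNReal.ofReal (NormedSpace.exp (S + ∑ i, G (z i))).trace
        ∂(Measure.pi fun _ : Fin n => μ) ≤
      ENNReal.ofReal (c ^ n * (NormedSpace.exp S).trace) := by
  induction n generalizing S with
  | zero => simp
  | succ n ih =>
    have hmp := (measurePreserving_piFinSuccAbove (fun _ : Fin (n + 1) => μ) 0).symm
    have hmeas : ∀ T : Matrix ι ι ℝ, ∀ m : ℕ, Measurable fun z : Fin m → α =>
        ENNReal.ofReal (NormedSpace.exp (T + ∑ i, G (z i))).trace := by
      intro T m
      refine (measurable_trace_exp fun i j => ?_).ennreal_ofReal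
      simp only [Matrix.add_apply, Matrix.sum_apply]
      exact measurable_const.add
        (Finset.measurable_sum _ fun k _ => (hGm i j).comp (measurable_pi_apply k))
    have hm2 : Measurable fun p : α × (Fin n → α) =>
        ENNReal.ofReal (NormedSpace.exp (S + ∑ i,
          G ((MeasurableEquiv.piFinSuccAbove (fun _ : Fin (n + 1) => α) 0).symm p i))).trace :=
      (hmeas S (n + 1)).comp hmp.measurable
    rw [← hmp.lintegral_comp (hmeas S (n + 1)), lintegral_prod _ hm2.aemeasurable]
    have hin : ∀ x : α, ∫⁻ y, ENNReal.ofReal (NormedSpace.exp (S + ∑ i,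
        G ((MeasurableEquiv.piFinSuccAbove (fun _ : Fin (n + 1) => α) 0).symm (x, y) i))).trace
        ∂(Measure.pi fun _ : Fin n => μ) ≤
        ENNReal.ofReal (c ^ n) * ENNReal.ofReal (NormedSpace.exp (S + G x)).trace := by
      intro x
      rw [← ENNReal.ofReal_mul (by positivity)]
      refine le_trans (le_of_eq ?_) (ih (hS.add (hG x)))
      refine lintegral_congr fun y => ?_
      rw [Fin.sum_univ_succ, add_assoc]
      simp [MeasurableEquiv.piFinSuccAbove_symm_apply]
    refine (lintegral_mono hin).trans ?_
    rw [lintegral_const_mul']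
    · refine (mul_le_mul_right (hstep S hS) _).trans_eq ?_
      rw [← ENNReal.ofReal_mul (by positivity), pow_succ, mul_assoc]
    · exact ENNReal.ofReal_ne_top

/-- Matrix Chernoff bound for the influence-function estimator. -/
theorem measure_trace_exp_ge_le [IsProbabilityMeasure μ] {Φ R : α → Matrix ι ι ℝ} {ρ : ℝ}
    (hρ0 : 0 ≤ ρ) (hΦ : ∀ z, (Φ z).IsHermitian) (hΦm : ∀ i j, Measurable fun z => Φ z i j)
    (hΦi : ∀ i j, Integrable (fun z => Φ z i j) μ) (hRi : ∀ i j, Integrable (fun z => R z i j) μ)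
    (hR : ∀ z w, w ⬝ᵥ ((NormedSpace.exp (Φ z) + NormedSpace.exp (-Φ z)) *ᵥ w) ≤
      w ⬝ᵥ (((2 : ℝ) • (1 : Matrix ι ι ℝ) + R z) *ᵥ w))
    (hρ : ∀ w, ∫ z, w ⬝ᵥ (R z *ᵥ w) ∂μ ≤ 2 * ρ * (w ⬝ᵥ w)) (n : ℕ) (s : ℝ) :
    (Measure.pi fun _ : Fin n => μ) {z | Real.exp s ≤ (NormedSpace.exp
        (∑ i, (1 / 2 : ℝ) • (Φ (z i) - meanMatrix μ Φ))).trace} ≤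
      ENNReal.ofReal ((1 + ρ) ^ n * Fintype.card ι * Real.exp (-s)) := by
  have hB : (meanMatrix μ Φ).IsHermitian := isHermitian_of_transpose_eq
    (transpose_meanMatrix μ fun z => transpose_eq_of_isHermitian (hΦ z))
  have hG : ∀ z, ((1 / 2 : ℝ) • (Φ z - meanMatrix μ Φ)).IsHermitian := fun z =>
    isHermitian_of_transpose_eq (by
      rw [Matrix.transpose_smul, Matrix.transpose_sub, transpose_eq_of_isHermitian (hΦ z),
        transpose_eq_of_isHermitian hB])
  have hGm : ∀ i j, Measurable fun z => ((1 / 2 : ℝ) • (Φ z - meanMatrix μ Φ)) i j := fun i j => by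
    simp only [Matrix.smul_apply, Matrix.sub_apply, smul_eq_mul]
    exact ((hΦm i j).sub_const _).const_mul _
  have h := lintegral_trace_exp_sum_le (μ := μ) hG hGm (c := 1 + ρ) (by positivity)
    (fun S hS => lintegral_trace_exp_centered_le hΦ hΦi hRi hR hρ hS) n
    (S := 0) Matrix.isHermitian_zero
  simp only [zero_add, NormedSpace.exp_zero, Matrix.trace_one] at h
  have hsub : {z : Fin n → α | Real.exp s ≤ (NormedSpace.exp
        (∑ i, (1 / 2 : ℝ) • (Φ (z i) - meanMatrix μ Φ))).trace} ⊆
      {z | ENNReal.ofReal (Real.exp s) ≤ ENNReal.ofReal (NormedSpace.exp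
        (∑ i, (1 / 2 : ℝ) • (Φ (z i) - meanMatrix μ Φ))).trace} :=
    fun z hz => ENNReal.ofReal_le_ofReal hz
  refine (measure_mono hsub).trans ((meas_ge_le_lintegral_div ?_ ?_ ENNReal.ofReal_ne_top).trans ?_)
  · refine (measurable_trace_exp fun i j => ?_).ennreal_ofReal.aemeasurable
    simp only [Matrix.sum_apply]
    exact Finset.measurable_sum _ fun k _ => (hGm i j).comp (measurable_pi_apply k)
  · simp [Real.exp_pos]
  · refine (ENNReal.div_le_div_right h _).trans_eq ?_
    rw [← ENNReal.ofReal_div_of_pos (Real.exp_pos s), Real.exp_neg, div_eq_mul_inv]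

end Concentration

/-! ### Deviation of sums of truncated matrices. -/

section Truncation

variable {ι α : Type*} [Fintype ι] [DecidableEq ι] [MeasurableSpace α] {μ : Measure α}
  {Z : α → Matrix ι ι ℝ} {φ : ℝ → ℝ}

theorem cfc_isHermitian {A : Matrix ι ι ℝ} (hA : A.IsHermitian) (f : ℝ → ℝ) :
    (hA.cfc f).IsHermitian :=
  isHermitian_of_transpose_eq (transpose_cfc hA f)

theorem IsInfluence.exp_cfc_quad_le (hφ : IsInfluence φ) {A : Matrix ι ι ℝ} (hA : A.IsHermitian)
    (w : ι → ℝ) :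
    w ⬝ᵥ ((NormedSpace.exp (hA.cfc φ) + NormedSpace.exp (-hA.cfc φ)) *ᵥ w) ≤
      w ⬝ᵥ (((2 : ℝ) • (1 : Matrix ι ι ℝ) + A * A) *ᵥ w) := by
  rw [← cfc_neg_eq, exp_cfc, exp_cfc, cfc_add_cfc, ← cfc_sq_eq hA, ← cfc_one_eq hA,
    ← cfc_const_mul, cfc_add_cfc]
  exact quad_cfc_mono hA (fun x => by simpa using hφ.exp_add_exp_neg_le x) w

theorem IsInfluence.cfc_sub_quad_le (hφ : IsInfluence φ) {A : Matrix ι ι ℝ} (hA : A.IsHermitian)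
    (w : ι → ℝ) :
    |w ⬝ᵥ (hA.cfc φ *ᵥ w) - w ⬝ᵥ (A *ᵥ w)| ≤ 1 / 2 * (w ⬝ᵥ ((A * A) *ᵥ w)) := by
  have h1 : w ⬝ᵥ (A *ᵥ w) = w ⬝ᵥ ((hA.cfc fun x => x) *ᵥ w) := by rw [cfc_id_eq]
  have h2 : 1 / 2 * (w ⬝ᵥ ((A * A) *ᵥ w)) = w ⬝ᵥ ((hA.cfc fun x => 1 / 2 * x ^ 2) *ᵥ w) := by
    rw [cfc_const_mul, cfc_sq_eq, Matrix.smul_mulVec, dotProduct_smul, smul_eq_mul]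
  have h3 : ∀ f g : ℝ → ℝ, w ⬝ᵥ (hA.cfc f *ᵥ w) + w ⬝ᵥ (hA.cfc g *ᵥ w) =
      w ⬝ᵥ ((hA.cfc fun x => f x + g x) *ᵥ w) := fun f g => by
    rw [← cfc_add_cfc, Matrix.add_mulVec, dotProduct_add]
  rw [abs_le, h2, h1, neg_le_sub_iff_le_add, sub_le_iff_le_add, h3, add_comm, h3]
  exact ⟨quad_cfc_mono hA (fun x => by linarith [hφ.neg_le x]) w, quad_cfc_mono hA (fun x => by linarith [hφ.le x]) w⟩

theorem IsInfluence.abs_cfc_apply_le (hφ : IsInfluence φ) {A : Matrix ι ι ℝ} (hA : A.IsHermitian)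
    (i j : ι) : |hA.cfc φ i j| ≤ 1 + (A * A) j j := by
  have hq : ∀ B : Matrix ι ι ℝ, Pi.single j 1 ⬝ᵥ (B *ᵥ Pi.single j 1) = B j j := fun B => by
    simp
  have h1 := quad_cfc_mono hA hφ.sq_le (Pi.single j 1)
  rw [← cfc_mul_cfc, cfc_sq_eq, hq, hq] at h1
  have h2 : hA.cfc φ i j ^ 2 ≤ (hA.cfc φ * hA.cfc φ) j j := by
    rw [Matrix.mul_apply]
    have h3 : ∀ k, hA.cfc φ j k = hA.cfc φ k j := fun k =>
      congrFun (congrFun (transpose_cfc hA φ) k) j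
    simp only [h3, ← pow_two]
    exact Finset.single_le_sum (f := fun k => hA.cfc φ k j ^ 2) (fun k _ => sq_nonneg _)
      (Finset.mem_univ i)
  have h4 : |hA.cfc φ i j| ≤ 1 + hA.cfc φ i j ^ 2 := by
    rw [← sq_abs]
    nlinarith [sq_nonneg (|hA.cfc φ i j| - 1), abs_nonneg (hA.cfc φ i j)]
  linarith

/-- Deviation bound for the sum of truncated random matrices. -/
theorem IsInfluence.measure_deviation_le [IsProbabilityMeasure μ] (hφ : IsInfluence φ)
    (hZ : ∀ z, (Z z).IsHermitian) (hZm : ∀ i j, Measurable fun z => Z z i j)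
    (hZi : ∀ i j, Integrable (fun z => Z z i j) μ)
    (hZZi : ∀ i j, Integrable (fun z => (Z z * Z z) i j) μ) {ρ : ℝ} (hρ0 : 0 ≤ ρ)
    (hρ : ∀ w, ∫ z, w ⬝ᵥ ((Z z * Z z) *ᵥ w) ∂μ ≤ 2 * ρ * (w ⬝ᵥ w)) (n : ℕ) (s : ℝ) :
    (Measure.pi fun _ : Fin n => μ) {z | ¬ ∀ w,
        |w ⬝ᵥ ((∑ i, (hZ (z i)).cfc φ - (n : ℝ) • meanMatrix μ Z) *ᵥ w)| ≤
          (2 * s + n * ρ) * (w ⬝ᵥ w)} ≤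
      ENNReal.ofReal (2 * ((1 + ρ) ^ n * Fintype.card ι * Real.exp (-s))) := by
  set Φ : α → Matrix ι ι ℝ := fun z => (hZ z).cfc φ with hΦdef
  have hΦ : ∀ z, (Φ z).IsHermitian := fun z => cfc_isHermitian (hZ z) φ
  have hΦm : ∀ i j, Measurable fun z => Φ z i j := measurable_cfc hZ hZm hφ.1.measurable
  have hΦi : ∀ i j, Integrable (fun z => Φ z i j) μ := fun i j =>
    ((integrable_const (1 : ℝ)).add (hZZi j j)).mono' (hΦm i j).aestronglyMeasurable
      (Filter.Eventually.of_forall fun z => hφ.abs_cfc_apply_le (hZ z) i j)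
  have hR := fun z => hφ.exp_cfc_quad_le (hZ z)
  have hRneg : ∀ z w, w ⬝ᵥ ((NormedSpace.exp (-Φ z) + NormedSpace.exp (- -Φ z)) *ᵥ w) ≤
      w ⬝ᵥ (((2 : ℝ) • (1 : Matrix ι ι ℝ) + Z z * Z z) *ᵥ w) := fun z w => by
    rw [neg_neg, add_comm]
    exact hR z w
  -- The hypothesis on `e^Φ + e^{-Φ}` is even in `Φ`, so one bound serves both tails; this is the
  -- factor 2 in the probability.
  have b1 := measure_trace_exp_ge_le hρ0 hΦ hΦm hΦi hZZi hR hρ n s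
  have b2 := measure_trace_exp_ge_le (Φ := fun z => -Φ z) hρ0 (fun z => (hΦ z).neg)
    (fun i j => (hΦm i j).neg) (fun i j => (hΦi i j).neg) hZZi hRneg hρ n s
  have hmneg : meanMatrix μ (fun z => -Φ z) = -meanMatrix μ Φ := by
    ext i j
    simp only [meanMatrix, Matrix.of_apply, Matrix.neg_apply]
    exact integral_neg _
  rw [two_mul ((1 + ρ) ^ n * _ * _), ENNReal.ofReal_add (by positivity) (by positivity)]
  refine le_trans (measure_mono ?_) ((measure_union_le _ _).trans (add_le_add b1 b2))
  intro z hz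
  by_contra hcon
  simp only [Set.mem_union, Set.mem_ofPred_eq, not_or, not_le] at hcon
  apply hz
  intro w
  have hB : (meanMatrix μ Φ).IsHermitian := isHermitian_of_transpose_eq
    (transpose_meanMatrix μ fun z => transpose_eq_of_isHermitian (hΦ z))
  have hG : ∀ i, ((1 / 2 : ℝ) • (Φ (z i) - meanMatrix μ Φ)).IsHermitian := fun i =>
    isHermitian_of_transpose_eq (by
      rw [Matrix.transpose_smul, Matrix.transpose_sub, transpose_eq_of_isHermitian (hΦ _),
        transpose_eq_of_isHermitian hB])
  have hsumneg : ∑ i, (1 / 2 : ℝ) • (-Φ (z i) - meanMatrix μ fun z => -Φ z) =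
      -∑ i, (1 / 2 : ℝ) • (Φ (z i) - meanMatrix μ Φ) := by
    rw [hmneg, ← Finset.sum_neg_distrib]
    exact Finset.sum_congr rfl fun i _ => by module
  rw [hsumneg] at hcon
  have q1 := exp_quad_le_trace_exp (sum_isHermitian hG) hcon.1 w
  have q2 := exp_quad_le_trace_exp (sum_isHermitian hG).neg hcon.2 w
  rw [Matrix.neg_mulVec, dotProduct_neg] at q2
  -- The factor `1/2` of the centering argument turns the level `s` into a fluctuation of `2s`.
  have hsum : ∑ i, (1 / 2 : ℝ) • (Φ (z i) - meanMatrix μ Φ) =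
      (1 / 2 : ℝ) • (∑ i, Φ (z i) - (n : ℝ) • meanMatrix μ Φ) := by
    rw [← Finset.smul_sum, Finset.sum_sub_distrib, Finset.sum_const, Finset.card_univ,
      Fintype.card_fin, Nat.cast_smul_eq_nsmul]
  rw [hsum, Matrix.smul_mulVec, dotProduct_smul, smul_eq_mul, Matrix.sub_mulVec, dotProduct_sub,
    Matrix.smul_mulVec, dotProduct_smul, smul_eq_mul] at q1 q2
  -- Truncation shifts the mean by at most half the second moment, that is `ρ` per observation.
  have hbias : |w ⬝ᵥ (meanMatrix μ Φ *ᵥ w) - w ⬝ᵥ (meanMatrix μ Z *ᵥ w)| ≤ ρ * (w ⬝ᵥ w) := by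
    rw [quad_meanMatrix hΦi, quad_meanMatrix hZi,
      ← integral_sub (integrable_quad hΦi w) (integrable_quad hZi w)]
    refine (abs_integral_le_integral_abs).trans ?_
    refine (integral_mono_of_nonneg (Filter.Eventually.of_forall fun z => abs_nonneg _)
      ((integrable_quad hZZi w).const_mul (1 / 2))
      (Filter.Eventually.of_forall fun z => hφ.cfc_sub_quad_le (hZ z) w)).trans ?_
    rw [integral_const_mul]
    linarith [hρ w]
  rw [Matrix.sub_mulVec, dotProduct_sub, Matrix.smul_mulVec, dotProduct_smul, smul_eq_mul]
  rw [abs_le] at hbias ⊢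
  have hn : (0 : ℝ) ≤ n := Nat.cast_nonneg n
  have n1 := mul_le_mul_of_nonneg_left hbias.1 hn
  have n2 := mul_le_mul_of_nonneg_left hbias.2 hn
  constructor <;> nlinarith

end Truncation

/-! ### Fourth moments of sums of independent centred variables. -/

section FourthMoment

variable {Ω : Type*} [MeasurableSpace Ω] {ν : Measure Ω}

theorem abs_pow_le_one_add_pow_four {k : ℕ} (hk : k ≤ 4) (x : ℝ) : |x ^ k| ≤ 1 + x ^ 4 := by
  have h4 : x ^ 4 = |x| ^ 4 := by rw [← abs_pow, abs_of_nonneg (by positivity)]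
  rw [abs_pow, h4]
  rcases le_total |x| 1 with h | h
  · have := pow_le_one₀ (n := k) (abs_nonneg x) h
    have : 0 ≤ |x| ^ 4 := by positivity
    linarith
  · have := pow_le_pow_right₀ h hk
    linarith

theorem integrable_pow_of_pow_four [IsFiniteMeasure ν] {T : Ω → ℝ} (hT : AEMeasurable T ν)
    (h4 : Integrable (fun ω => T ω ^ 4) ν) {k : ℕ} (hk : k ≤ 4) :
    Integrable (fun ω => T ω ^ k) ν :=
  ((integrable_const (1 : ℝ)).add h4).mono' (hT.pow_const k).aestronglyMeasurable
    (Filter.Eventually.of_forall fun ω => abs_pow_le_one_add_pow_four hk (T ω))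

theorem integrable_add_pow_four {T U : Ω → ℝ} (hT : AEMeasurable T ν) (hU : AEMeasurable U ν)
    (hT4 : Integrable (fun ω => T ω ^ 4) ν) (hU4 : Integrable (fun ω => U ω ^ 4) ν) :
    Integrable (fun ω => (T ω + U ω) ^ 4) ν := by
  refine ((hT4.add hU4).const_mul 8).mono' ((hT.add hU).pow_const 4).aestronglyMeasurable
    (Filter.Eventually.of_forall fun ω => ?_)
  rw [Real.norm_eq_abs, abs_of_nonneg (by positivity), Pi.add_apply]
  have h1 : (T ω + U ω) ^ 2 ≤ 2 * (T ω ^ 2 + U ω ^ 2) := by nlinarith [sq_nonneg (T ω - U ω)]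
  have h2 : ((T ω + U ω) ^ 2) ^ 2 ≤ (2 * (T ω ^ 2 + U ω ^ 2)) ^ 2 :=
    pow_le_pow_left₀ (sq_nonneg _) h1 2
  nlinarith [sq_nonneg (T ω ^ 2 - U ω ^ 2)]

theorem integral_add_sq_of_indepFun [IsProbabilityMeasure ν] {T U : Ω → ℝ} (hTU : IndepFun T U ν)
    (hT : AEMeasurable T ν) (hU : AEMeasurable U ν)
    (hT4 : Integrable (fun ω => T ω ^ 4) ν) (hU4 : Integrable (fun ω => U ω ^ 4) ν)
    (hT0 : ∫ ω, T ω ∂ν = 0) (hU0 : ∫ ω, U ω ∂ν = 0) :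
    ∫ ω, (T ω + U ω) ^ 2 ∂ν = ∫ ω, T ω ^ 2 ∂ν + ∫ ω, U ω ^ 2 ∂ν ∧
    ∫ ω, (T ω + U ω) ^ 4 ∂ν = ∫ ω, T ω ^ 4 ∂ν + 6 * ((∫ ω, T ω ^ 2 ∂ν) * ∫ ω, U ω ^ 2 ∂ν) +
      ∫ ω, U ω ^ 4 ∂ν := by
  have hTi : ∀ k ≤ 4, Integrable (fun ω => T ω ^ k) ν := fun k hk =>
    integrable_pow_of_pow_four hT hT4 hk
  have hUi : ∀ k ≤ 4, Integrable (fun ω => U ω ^ k) ν := fun k hk =>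
    integrable_pow_of_pow_four hU hU4 hk
  have hind : ∀ k l : ℕ, IndepFun (fun ω => T ω ^ k) (fun ω => U ω ^ l) ν := fun k l =>
    hTU.comp (measurable_id.pow_const k) (measurable_id.pow_const l)
  have hi : ∀ k ≤ 4, ∀ l ≤ 4, Integrable (fun ω => T ω ^ k * U ω ^ l) ν := fun k hk l hl =>
    (hind k l).integrable_mul (hTi k hk) (hUi l hl)
  have hm : ∀ k l : ℕ, ∫ ω, T ω ^ k * U ω ^ l ∂ν = (∫ ω, T ω ^ k ∂ν) * ∫ ω, U ω ^ l ∂ν :=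
    fun k l => (hind k l).integral_fun_mul_eq_mul_integral
      (hT.pow_const k).aestronglyMeasurable (hU.pow_const l).aestronglyMeasurable
  have hT1 : ∫ ω, T ω ^ 1 ∂ν = 0 := by simpa using hT0
  have hU1 : ∫ ω, U ω ^ 1 ∂ν = 0 := by simpa using hU0
  constructor
  · have e : ∀ ω, (T ω + U ω) ^ 2 = T ω ^ 2 + 2 * (T ω ^ 1 * U ω ^ 1) + U ω ^ 2 := fun ω => by ring
    simp only [e]
    have j1 := (hi 1 (by norm_num) 1 (by norm_num)).const_mul 2
    rw [integral_add ((hTi 2 (by norm_num)).fun_add j1) (hUi 2 (by norm_num)),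
      integral_add (hTi 2 (by norm_num)) j1, integral_const_mul, hm, hT1]
    ring
  · have e : ∀ ω, (T ω + U ω) ^ 4 = T ω ^ 4 + 4 * (T ω ^ 3 * U ω ^ 1) + 6 * (T ω ^ 2 * U ω ^ 2) +
        4 * (T ω ^ 1 * U ω ^ 3) + U ω ^ 4 := fun ω => by ring
    simp only [e]
    have j1 := (hi 3 (by norm_num) 1 (by norm_num)).const_mul 4
    have j2 := (hi 2 (by norm_num) 2 (by norm_num)).const_mul 6
    have j3 := (hi 1 (by norm_num) 3 (by norm_num)).const_mul 4
    rw [integral_add (((hT4.fun_add j1).fun_add j2).fun_add j3) hU4,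
      integral_add ((hT4.fun_add j1).fun_add j2) j3, integral_add (hT4.fun_add j1) j2, integral_add hT4 j1, integral_const_mul, integral_const_mul,
      integral_const_mul, hm, hm, hm, hT1, hU1]
    ring

/-- Second and fourth moments of a sum of independent centred random variables. -/
theorem moments_sum_of_iIndepFun [IsProbabilityMeasure ν] {κ : Type*} {η : κ → Ω → ℝ}
    (hind : iIndepFun η ν) (hm : ∀ k, Measurable (η k))
    (h4 : ∀ k, Integrable (fun ω => η k ω ^ 4) ν) (h0 : ∀ k, ∫ ω, η k ω ∂ν = 0) {σ : ℝ}
    (hσ : 0 ≤ σ) {b : κ → ℝ} (hb : ∀ k, 0 ≤ b k) (hη2 : ∀ k, ∫ ω, η k ω ^ 2 ∂ν ≤ σ * b k)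
    (hη4 : ∀ k, ∫ ω, η k ω ^ 4 ∂ν ≤ σ ^ 2 * b k ^ 2) (J : Finset κ) :
    Integrable (fun ω => (∑ k ∈ J, η k ω) ^ 4) ν ∧ ∫ ω, ∑ k ∈ J, η k ω ∂ν = 0 ∧
      ∫ ω, (∑ k ∈ J, η k ω) ^ 2 ∂ν ≤ σ * ∑ k ∈ J, b k ∧
      ∫ ω, (∑ k ∈ J, η k ω) ^ 4 ∂ν ≤ 3 * σ ^ 2 * (∑ k ∈ J, b k) ^ 2 := by
  classical
  induction J using Finset.induction_on with
  | empty => simp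
  | insert k J hk ih =>
    obtain ⟨i4, i0, i2, i44⟩ := ih
    have hmJ : Measurable fun ω => ∑ l ∈ J, η l ω := Finset.measurable_sum _ fun l _ => hm l
    have hIJ : IndepFun (fun ω => ∑ l ∈ J, η l ω) (η k) ν := by
      have h := hind.indepFun_finsetSum_of_notMem hm hk
      convert! h using 1
      funext ω
      simp
    obtain ⟨s2, s4⟩ := integral_add_sq_of_indepFun hIJ hmJ.aemeasurable (hm k).aemeasurable i4
      (h4 k) i0 (h0 k)
    have hi1 : ∀ l, Integrable (η l) ν := fun l => by
      simpa using integrable_pow_of_pow_four (hm l).aemeasurable (h4 l) (k := 1) (by norm_num)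
    have hcomm : ∀ ω, ∑ l ∈ insert k J, η l ω = ∑ l ∈ J, η l ω + η k ω := fun ω => by
      rw [Finset.sum_insert hk, add_comm]
    simp only [hcomm]
    rw [Finset.sum_insert hk]
    refine ⟨integrable_add_pow_four hmJ.aemeasurable (hm k).aemeasurable i4 (h4 k), ?_, ?_, ?_⟩
    · rw [integral_add (integrable_finsetSum _ fun l _ => hi1 l) (hi1 k), i0, h0 k, add_zero]
    · rw [s2]
      linarith [hη2 k]
    · rw [s4]
      have hB : 0 ≤ ∑ l ∈ J, b l := Finset.sum_nonneg fun l _ => hb l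
      have hprod : (∫ ω, (∑ l ∈ J, η l ω) ^ 2 ∂ν) * ∫ ω, η k ω ^ 2 ∂ν ≤
          (σ * ∑ l ∈ J, b l) * (σ * b k) :=
        mul_le_mul i2 (hη2 k) (integral_nonneg fun ω => sq_nonneg _) (by positivity)
      -- With `B = ∑ l ∈ J, b l`, the step is `3B² + 6B b_k + b_k² ≤ 3(B + b_k)²`, scaled by `σ²`;
      -- the cross term dictates the constant 3.
      have h5 := hη4 k
      nlinarith [mul_nonneg (sq_nonneg σ) (sq_nonneg (b k))]

/-- The fourth moment of a linear combination of independent centred variables. -/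
theorem integral_linear_comb_pow_four_le [IsProbabilityMeasure ν] {κ : Type*} [Fintype κ]
    {ξ : κ → Ω → ℝ} (hind : iIndepFun ξ ν) (hm : ∀ k, Measurable (ξ k))
    (h4 : ∀ k, Integrable (fun ω => ξ k ω ^ 4) ν) (h0 : ∀ k, ∫ ω, ξ k ω ∂ν = 0) {M : ℝ}
    (hM : 0 < M) (hξ : ∀ k, ∫ ω, ξ k ω ^ 4 ∂ν ≤ M) (a : κ → ℝ) :
    Integrable (fun ω => (∑ k, ξ k ω * a k) ^ 4) ν ∧
      ∫ ω, (∑ k, ξ k ω * a k) ^ 4 ∂ν ≤ 3 * M * (∑ k, a k ^ 2) ^ 2 := by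
  have hσ : 0 < √M := Real.sqrt_pos.mpr hM
  have hσ2 : √M ^ 2 = M := Real.sq_sqrt hM.le
  have hind' : iIndepFun (fun k ω => ξ k ω * a k) ν :=
    hind.comp (fun k x => x * a k) fun k => measurable_id.mul_const _
  -- Integrating `2√M ξ² ≤ ξ⁴ + M` gives the second moment, so the moment lemma applies with `σ =
  -- √M` and `b_k = a_k²`.
  have hξ2 : ∀ k, ∫ ω, ξ k ω ^ 2 ∂ν ≤ √M := fun k => by
    have i2 := integrable_pow_of_pow_four (hm k).aemeasurable (h4 k) (k := 2) (by norm_num)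
    have h := integral_mono (i2.const_mul (2 * √M)) ((h4 k).add (integrable_const (√M ^ 2)))
      (fun ω => by
        simp only [Pi.add_apply]
        nlinarith [sq_nonneg (ξ k ω ^ 2 - √M)])
    rw [integral_const_mul, integral_add' (h4 k) (integrable_const _)] at h
    simp only [integral_const, probReal_univ, one_smul] at h
    have h6 : √M * ∫ ω, ξ k ω ^ 2 ∂ν ≤ √M * √M := by nlinarith [hξ k]
    exact le_of_mul_le_mul_left h6 hσ
  have h := moments_sum_of_iIndepFun hind' (fun k => (hm k).mul_const _)
    (fun k => by simpa only [mul_pow] using (h4 k).mul_const (a k ^ 4))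
    (fun k => by rw [integral_mul_const, h0 k, zero_mul]) hσ.le (b := fun k => a k ^ 2)
    (fun k => sq_nonneg _)
    (fun k => by
      simp only [mul_pow]
      rw [integral_mul_const]
      exact mul_le_mul_of_nonneg_right (hξ2 k) (sq_nonneg _))
    (fun k => by
      simp only [mul_pow]
      rw [integral_mul_const, hσ2, ← pow_mul]
      exact mul_le_mul_of_nonneg_right (hξ k) (by positivity)) Finset.univ
  rw [hσ2] at h
  exact ⟨h.1, h.2.2.2⟩

end FourthMoment

/-! ### Redrawing one coordinate of a product measure. -/

section Resampling

variable {κ : Type*} [Fintype κ] [DecidableEq κ] {X : κ → Type*} [∀ k, MeasurableSpace (X k)]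
  {μ : ∀ k, Measure (X k)} [∀ k, IsProbabilityMeasure (μ k)]

/-- Redrawing one coordinate independently leaves the product law unchanged, which allows Fubini in
that coordinate without reindexing the product. -/
theorem measurePreserving_update (j : κ) :
    MeasurePreserving (fun p : (∀ k, X k) × X j => Function.update p.1 j p.2)
      ((Measure.pi μ).prod (μ j)) (Measure.pi μ) := by
  have hm : Measurable fun p : (∀ k, X k) × X j => Function.update p.1 j p.2 := by
    refine measurable_pi_iff.mpr fun k => ?_
    by_cases hk : k = j
    · subst hk
      simpa using measurable_snd
    · simp only [Function.update_of_ne hk]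
      exact (measurable_pi_apply k).comp measurable_fst
  refine ⟨hm, (Measure.pi_eq fun s hs => ?_).symm⟩
  have hpre : (fun p : (∀ k, X k) × X j => Function.update p.1 j p.2) ⁻¹' Set.univ.pi s =
      (Set.univ.pi (Function.update s j Set.univ)) ×ˢ s j := by
    ext p
    simp only [Set.mem_preimage, Set.mem_pi, Set.mem_univ, forall_true_left, Set.mem_prod]
    constructor
    · intro h
      refine ⟨fun k => ?_, by simpa using h j⟩
      by_cases hk : k = j
      · subst hk; simp
      · simpa [Function.update_of_ne hk] using h k
    · rintro ⟨h1, h2⟩ k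
      by_cases hk : k = j
      · subst hk; simpa using h2
      · simpa [Function.update_of_ne hk] using h1 k
  rw [Measure.map_apply hm (MeasurableSet.univ_pi hs), hpre, Measure.prod_prod, Measure.pi_pi,
    ← Finset.mul_prod_erase _ _ (Finset.mem_univ j), Function.update_self, measure_univ, one_mul,
    ← Finset.mul_prod_erase Finset.univ (fun i => μ i (s i)) (Finset.mem_univ j), mul_comm]
  congr 1
  refine Finset.prod_congr rfl fun k hk => ?_
  rw [Function.update_of_ne (Finset.ne_of_mem_erase hk)]

theorem ae_integrable_update {G : (∀ k, X k) → ℝ} (hG : Integrable G (Measure.pi μ)) (j : κ) :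
    ∀ᵐ x ∂(Measure.pi μ), Integrable (fun u => G (Function.update x j u)) (μ j) :=
  ((measurePreserving_update j).integrable_comp_of_integrable hG).prod_right_ae

theorem integral_update {G : (∀ k, X k) → ℝ} (hG : Integrable G (Measure.pi μ)) (j : κ) :
    ∫ x, ∫ u, G (Function.update x j u) ∂(μ j) ∂(Measure.pi μ) = ∫ x, G x ∂(Measure.pi μ) := by
  have hmp := measurePreserving_update (μ := μ) j
  have h := integral_map hmp.aemeasurable (f := G) (by rw [hmp.map_eq]; exact hG.1)
  rw [hmp.map_eq] at h
  rw [h]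
  exact (integral_prod _ (hmp.integrable_comp_of_integrable hG)).symm

/-- To compare two integrals over a product space it is enough to compare the integrals over one
coordinate, the others being fixed. -/
theorem integral_eq_of_update {G₁ G₂ G₃ : (∀ k, X k) → ℝ} (h₁ : Integrable G₁ (Measure.pi μ))
    (h₂ : Integrable G₂ (Measure.pi μ)) (h₃ : Integrable G₃ (Measure.pi μ)) (j : κ)
    (h : ∀ x, Integrable (fun u => G₁ (Function.update x j u)) (μ j) →
      Integrable (fun u => G₂ (Function.update x j u)) (μ j) →
      Integrable (fun u => G₃ (Function.update x j u)) (μ j) →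
      ∫ u, G₁ (Function.update x j u) ∂(μ j) = ∫ u, G₂ (Function.update x j u) ∂(μ j)) :
    ∫ x, G₁ x ∂(Measure.pi μ) = ∫ x, G₂ x ∂(Measure.pi μ) := by
  rw [← integral_update h₁ j, ← integral_update h₂ j]
  refine integral_congr_ae ?_
  filter_upwards [ae_integrable_update h₁ j, ae_integrable_update h₂ j,
    ae_integrable_update h₃ j] with x a b c
  exact h x a b c

end Resampling

/-! ### Stein's identity for the score. -/

section Stein

variable {p : ℝ → ℝ}

theorem integrable_of_integral_eq_one {p : ℝ → ℝ} (h1 : ∫ u, p u = 1) : Integrable p := by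
  by_contra h
  rw [integral_undef h] at h1
  exact zero_ne_one h1

theorem isProbabilityMeasure_entryLaw (h0 : ∀ u, 0 ≤ p u) (h1 : ∫ u, p u = 1) :
    IsProbabilityMeasure (entryLaw p) := by
  refine ⟨?_⟩
  rw [entryLaw, withDensity_apply _ MeasurableSet.univ, Measure.restrict_univ,
    ← ofReal_integral_eq_lintegral_ofReal (integrable_of_integral_eq_one h1)
      (Filter.Eventually.of_forall h0), h1, ENNReal.ofReal_one]

theorem integrable_entryLaw_iff (h0 : ∀ u, 0 ≤ p u) (hd : Differentiable ℝ p) (g : ℝ → ℝ) :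
    Integrable g (entryLaw p) ↔ Integrable fun u => p u * g u := by
  rw [entryLaw, integrable_withDensity_iff_integrable_smul' hd.continuous.measurable.ennreal_ofReal
    (Filter.Eventually.of_forall fun u => ENNReal.ofReal_lt_top)]
  simp only [ENNReal.toReal_ofReal (h0 _), smul_eq_mul]

theorem integral_entryLaw (h0 : ∀ u, 0 ≤ p u) (hd : Differentiable ℝ p) (g : ℝ → ℝ) :
    ∫ u, g u ∂(entryLaw p) = ∫ u, p u * g u := by
  rw [entryLaw, integral_withDensity_eq_integral_toReal_smul
    hd.continuous.measurable.ennreal_ofReal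
    (Filter.Eventually.of_forall fun u => ENNReal.ofReal_lt_top)]
  simp only [ENNReal.toReal_ofReal (h0 _), smul_eq_mul]

/-- Where the density vanishes it has a minimum, so its derivative vanishes too and the convention
for division by zero does no harm. -/
theorem mul_score₀ (h0 : ∀ u, 0 ≤ p u) (u : ℝ) : p u * score₀ p u = -deriv p u := by
  by_cases hu : p u = 0
  · have hmin : IsLocalMin p u := Filter.Eventually.of_forall fun v => by rw [hu]; exact h0 v
    rw [hu, hmin.deriv_eq_zero]
    simp
  · rw [score₀, mul_div_cancel₀ _ hu]

theorem measurable_score₀ (hd : Differentiable ℝ p) : Measurable (score₀ p) :=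
  (measurable_deriv p).neg.div hd.continuous.measurable

/-- The one-dimensional Stein identity. -/
theorem integral_mul_score₀ (h0 : ∀ u, 0 ≤ p u) (hd : Differentiable ℝ p) {h h' : ℝ → ℝ}
    (hh : ∀ u, HasDerivAt h (h' u) u) (hi : Integrable h (entryLaw p))
    (hs : Integrable (fun u => h u * score₀ p u) (entryLaw p)) (hi' : Integrable h' (entryLaw p)) :
    ∫ u, h u * score₀ p u ∂(entryLaw p) = ∫ u, h' u ∂(entryLaw p) := by
  rw [integrable_entryLaw_iff h0 hd] at hi hs hi'
  have e1 : ∀ u, p u * (h u * score₀ p u) = -(h u * deriv p u) := fun u => by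
    rw [mul_left_comm, mul_score₀ h0, mul_neg]
  simp only [e1] at hs
  have hs' : Integrable (h * deriv p) :=
    hs.neg.congr (Filter.Eventually.of_forall fun u => neg_neg _)
  have hi'' : Integrable (h' * p) := hi'.congr (Filter.Eventually.of_forall fun u => mul_comm _ _)
  have hi0 : Integrable (h * p) := hi.congr (Filter.Eventually.of_forall fun u => mul_comm _ _)
  -- Integrability of `h p` removes the boundary terms; no decay of `p` is assumed.
  have key := integral_mul_deriv_eq_deriv_mul_of_integrable
    (fun u _ => hh u) (fun u _ => (hd u).hasDerivAt) hs' hi'' hi0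
  rw [integral_entryLaw h0 hd, integral_entryLaw h0 hd]
  simp only [e1]
  rw [integral_neg, key, neg_neg]
  exact integral_congr_ae (Filter.Eventually.of_forall fun u => mul_comm _ _)

theorem integral_score₀ (h0 : ∀ u, 0 ≤ p u) (hd : Differentiable ℝ p) (h1 : ∫ u, p u = 1)
    (hs : Integrable (score₀ p) (entryLaw p)) : ∫ u, score₀ p u ∂(entryLaw p) = 0 := by
  have := isProbabilityMeasure_entryLaw h0 h1
  have h := integral_mul_score₀ h0 hd (h := fun _ => 1) (h' := fun _ => 0)
    (fun u => hasDerivAt_const u 1) (integrable_const 1) (by simpa using hs) (integrable_zero _ _ _)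
  simpa using h

/-- Stein's identity for a ridge function of a vector with independent entries. -/
theorem integral_ridge_mul_score₀ (h0 : ∀ u, 0 ≤ p u) (hd : Differentiable ℝ p)
    (h1 : ∫ u, p u = 1) {κ : Type*} [Fintype κ] [DecidableEq κ] {f : ℝ → ℝ}
    (hf : Differentiable ℝ f) (b : κ → ℝ) (c : ℝ) (k : κ)
    (hs : Integrable (fun x : κ → ℝ => f (c + ∑ l, x l * b l) * score₀ p (x k))
      (Measure.pi fun _ => entryLaw p))
    (hi' : Integrable (fun x : κ → ℝ => deriv f (c + ∑ l, x l * b l) * b k)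
      (Measure.pi fun _ => entryLaw p))
    (hi : Integrable (fun x : κ → ℝ => f (c + ∑ l, x l * b l)) (Measure.pi fun _ => entryLaw p)) :
    ∫ x : κ → ℝ, f (c + ∑ l, x l * b l) * score₀ p (x k) ∂(Measure.pi fun _ => entryLaw p) =
      ∫ x : κ → ℝ, deriv f (c + ∑ l, x l * b l) * b k ∂(Measure.pi fun _ => entryLaw p) := by
  have := isProbabilityMeasure_entryLaw h0 h1
  -- The third function only carries integrability of the ridge function along almost every line, as
  -- the one-dimensional identity requires.
  refine integral_eq_of_update hs hi' hi k fun x a₁ a₂ a₃ => ?_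
  have e : ∀ u, c + ∑ l, Function.update x k u l * b l =
      u * b k + (c + ∑ l ∈ Finset.univ.erase k, x l * b l) := fun u => by
    rw [← Finset.add_sum_erase _ _ (Finset.mem_univ k), Function.update_self]
    have : ∑ l ∈ Finset.univ.erase k, Function.update x k u l * b l =
        ∑ l ∈ Finset.univ.erase k, x l * b l := Finset.sum_congr rfl fun l hl => by
      rw [Function.update_of_ne (Finset.ne_of_mem_erase hl)]
    rw [this]
    ring
  simp only [e, Function.update_self] at a₁ a₂ a₃ ⊢
  refine integral_mul_score₀ h0 hd (fun u => ?_) a₃ a₁ a₂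
  have hlin : HasDerivAt (fun u => u * b k + (c + ∑ l ∈ Finset.univ.erase k, x l * b l))
      (b k) u := by
    simpa using ((hasDerivAt_id u).mul_const (b k)).add_const
      (c + ∑ l ∈ Finset.univ.erase k, x l * b l)
  exact (hf _).hasDerivAt.comp u hlin

variable {d₁ d₂ : ℕ}

/-- Stein's identity for a ridge function of a matrix with independent entries. -/
theorem integral_traceInner_mul_score₀ (h0 : ∀ u, 0 ≤ p u) (hd : Differentiable ℝ p)
    (h1 : ∫ u, p u = 1) {f : ℝ → ℝ} (hf : Differentiable ℝ f) (B : Matrix (Fin d₁) (Fin d₂) ℝ)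
    (j : Fin d₁) (k : Fin d₂)
    (hs : Integrable (fun x => f (traceInner x B) * score₀ p (x j k)) (covariateLaw d₁ d₂ p))
    (hi' : Integrable (fun x => deriv f (traceInner x B)) (covariateLaw d₁ d₂ p))
    (hi : Integrable (fun x => f (traceInner x B)) (covariateLaw d₁ d₂ p)) :
    ∫ x, f (traceInner x B) * score₀ p (x j k) ∂(covariateLaw d₁ d₂ p) =
      (∫ x, deriv f (traceInner x B) ∂(covariateLaw d₁ d₂ p)) * B j k := by
  have := isProbabilityMeasure_entryLaw h0 h1
  rw [← integral_mul_const]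
  -- The covariate law is a product of row laws. Row `j` is redrawn, and the other rows enter as the
  -- constant of the ridge function.
  refine integral_eq_of_update (μ := fun _ : Fin d₁ => Measure.pi fun _ : Fin d₂ => entryLaw p)
    hs (hi'.mul_const (B j k)) hi j fun x a₁ a₂ a₃ => ?_
  have e : ∀ row : Fin d₂ → ℝ, traceInner (Function.update x j row) B =
      (∑ i ∈ Finset.univ.erase j, ∑ l, x i l * B i l) + ∑ l, row l * B j l := fun row => by
    refine (traceInner_eq_sum (Matrix.of (Function.update x j row)) B).trans ?_
    simp only [Matrix.of_apply]
    rw [← Finset.add_sum_erase _ _ (Finset.mem_univ j), Function.update_self, add_comm]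
    congr 1
    refine Finset.sum_congr rfl fun i hi => ?_
    rw [Function.update_of_ne (Finset.ne_of_mem_erase hi)]
  simp only [e, Function.update_self] at a₁ a₂ a₃ ⊢
  exact integral_ridge_mul_score₀ h0 hd h1 hf (B j) _ k a₁ a₂ a₃

end Stein

/-! ### Moments of the response and of score sums. -/

section Moments

variable {d₁ d₂ : ℕ}

theorem measurable_matrix_apply (j : Fin d₁) (k : Fin d₂) :
    Measurable fun x : Matrix (Fin d₁) (Fin d₂) ℝ => x j k :=
  (measurable_pi_apply k).comp (measurable_pi_apply (X := fun _ : Fin d₁ => Fin d₂ → ℝ) j)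

theorem measurable_traceInner (B : Matrix (Fin d₁) (Fin d₂) ℝ) :
    Measurable fun x : Matrix (Fin d₁) (Fin d₂) ℝ => traceInner x B := by
  simp only [traceInner_eq_sum]
  exact Finset.measurable_sum _ fun j _ => Finset.measurable_sum _ fun k _ =>
    (measurable_matrix_apply j k).mul_const _

namespace MatrixSIM

variable {r : ℕ} (m : MatrixSIM d₁ d₂ r)

theorem isProbabilityMeasure_entryLaw : IsProbabilityMeasure (entryLaw m.p₀) :=
  LowRankSIM.isProbabilityMeasure_entryLaw m.p₀_nonneg m.p₀_integral

theorem isProbabilityMeasure_covariateLaw : IsProbabilityMeasure (covariateLaw d₁ d₂ m.p₀) := by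
  have := m.isProbabilityMeasure_entryLaw
  exact inferInstanceAs (IsProbabilityMeasure
    (Measure.pi fun _ : Fin d₁ => Measure.pi fun _ : Fin d₂ => entryLaw m.p₀))

theorem measurePreserving_row (j : Fin d₁) :
    MeasurePreserving (fun x : Matrix (Fin d₁) (Fin d₂) ℝ => x j) (covariateLaw d₁ d₂ m.p₀)
      (Measure.pi fun _ => entryLaw m.p₀) := by
  have := m.isProbabilityMeasure_entryLaw
  exact measurePreserving_eval (fun _ : Fin d₁ => Measure.pi fun _ : Fin d₂ => entryLaw m.p₀) j

theorem measurePreserving_entry (j : Fin d₁) (k : Fin d₂) :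
    MeasurePreserving (fun x : Matrix (Fin d₁) (Fin d₂) ℝ => x j k) (covariateLaw d₁ d₂ m.p₀)
      (entryLaw m.p₀) := by
  have := m.isProbabilityMeasure_entryLaw
  exact (measurePreserving_eval (fun _ : Fin d₂ => entryLaw m.p₀) k).comp
    (m.measurePreserving_row j)

theorem measurable_response :
    Measurable fun z : Matrix (Fin d₁) (Fin d₂) ℝ × ℝ =>
      (z.1, m.f (traceInner z.1 m.βstar) + z.2) :=
  measurable_fst.prodMk (((m.f_differentiable.continuous.measurable.comp
    (measurable_traceInner m.βstar)).comp measurable_fst).add measurable_snd)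

theorem isProbabilityMeasure_dataLaw : IsProbabilityMeasure m.dataLaw := by
  have := m.isProbabilityMeasure_covariateLaw
  have := m.noise_prob
  exact Measure.isProbabilityMeasure_map m.measurable_response.aemeasurable

theorem measurePreserving_fst_dataLaw :
    MeasurePreserving Prod.fst m.dataLaw (covariateLaw d₁ d₂ m.p₀) := by
  have := m.isProbabilityMeasure_covariateLaw
  have := m.noise_prob
  refine ⟨measurable_fst, ?_⟩
  rw [MatrixSIM.dataLaw, Measure.map_map measurable_fst m.measurable_response]
  exact measurePreserving_fst.map_eq

theorem _root_.MeasureTheory.MeasurePreserving.integral_comp_of_measurable {α β : Type*}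
    [MeasurableSpace α] [MeasurableSpace β] {μ : Measure α} {ν : Measure β} {T : α → β}
    (hT : MeasurePreserving T μ ν) {g : β → ℝ} (hg : Measurable g) :
    ∫ x, g (T x) ∂μ = ∫ y, g y ∂ν := by
  rw [← hT.map_eq, integral_map hT.aemeasurable hg.aestronglyMeasurable]

variable {m} {M : ℝ}

theorem MomentBound.integral_score₀ (h : m.MomentBound M) :
    ∫ u, score₀ m.p₀ u ∂(entryLaw m.p₀) = 0 := by
  have := m.isProbabilityMeasure_entryLaw
  refine LowRankSIM.integral_score₀ m.p₀_nonneg m.p₀_differentiable m.p₀_integral ?_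
  simpa using integrable_pow_of_pow_four (measurable_score₀ m.p₀_differentiable).aemeasurable
    h.score_integrable (k := 1) (by norm_num)

theorem MomentBound.integrable_score_pow_four (h : m.MomentBound M) (j : Fin d₁) (k : Fin d₂) :
    Integrable (fun x => score₀ m.p₀ (x j k) ^ 4) (covariateLaw d₁ d₂ m.p₀) :=
  (m.measurePreserving_entry j k).integrable_comp_of_integrable h.score_integrable

theorem MomentBound.integrable_link_pow_four (h : m.MomentBound M) :
    Integrable (fun x => m.f (traceInner x m.βstar) ^ 4) (covariateLaw d₁ d₂ m.p₀) := by
  have := m.isProbabilityMeasure_covariateLaw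
  have := m.noise_prob
  have hF : Measurable fun x => m.f (traceInner x m.βstar) :=
    m.f_differentiable.continuous.measurable.comp (measurable_traceInner m.βstar)
  have h1 := h.response_integrable
  rw [MatrixSIM.dataLaw, integrable_map_measure (measurable_snd.pow_const 4).aestronglyMeasurable
    m.measurable_response.aemeasurable] at h1
  -- No fourth moment of the noise is assumed. Fubini supplies one noise value `e` for which the
  -- shifted link has a fourth moment, and subtracting a constant preserves this.
  obtain ⟨e, he⟩ := h1.prod_left_ae.exists
  have h2 := integrable_add_pow_four (T := fun x => m.f (traceInner x m.βstar) + e)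
    (U := fun _ => -e) (hF.add_const e).aemeasurable aemeasurable_const he (integrable_const _)
  simpa using h2

theorem integrable_mul_of_pow_four {Ω : Type*} [MeasurableSpace Ω] {ν : Measure Ω}
    [IsFiniteMeasure ν] {T U : Ω → ℝ} (hT : Measurable T) (hU : Measurable U)
    (hT4 : Integrable (fun ω => T ω ^ 4) ν) (hU4 : Integrable (fun ω => U ω ^ 4) ν) :
    Integrable (fun ω => T ω * U ω) ν := by
  refine ((integrable_pow_of_pow_four hT.aemeasurable hT4 (k := 2) (by norm_num)).add
    (integrable_pow_of_pow_four hU.aemeasurable hU4 (k := 2) (by norm_num))).mono'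
    (hT.mul hU).aestronglyMeasurable (Filter.Eventually.of_forall fun ω => ?_)
  rw [Real.norm_eq_abs, Pi.add_apply, abs_le]
  constructor <;> nlinarith [sq_nonneg (T ω + U ω), sq_nonneg (T ω - U ω)]

theorem measurable_score_entry (m : MatrixSIM d₁ d₂ r) (j : Fin d₁) (k : Fin d₂) :
    Measurable fun x : Matrix (Fin d₁) (Fin d₂) ℝ => score₀ m.p₀ (x j k) :=
  (measurable_score₀ m.p₀_differentiable).comp (measurable_matrix_apply j k)

/-- Stein's identity for the model: `E[Y S(X)] = μ β*`, entrywise. -/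
theorem MomentBound.integral_response_mul_score (h : m.MomentBound M) (j : Fin d₁) (k : Fin d₂) :
    ∫ z, z.2 * score₀ m.p₀ (z.1 j k) ∂m.dataLaw = m.mu * m.βstar j k := by
  have := m.isProbabilityMeasure_covariateLaw
  have := m.noise_prob
  have hF : Measurable fun x => m.f (traceInner x m.βstar) :=
    m.f_differentiable.continuous.measurable.comp (measurable_traceInner m.βstar)
  have hsm := measurable_score_entry m j k
  have hF4 := h.integrable_link_pow_four
  have hs4 := h.integrable_score_pow_four j k
  have hFs := integrable_mul_of_pow_four hF hsm hF4 hs4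
  have hF1 : Integrable (fun x => m.f (traceInner x m.βstar)) (covariateLaw d₁ d₂ m.p₀) := by
    simpa using integrable_pow_of_pow_four hF.aemeasurable hF4 (k := 1) (by norm_num)
  have hs1 : Integrable (fun x => score₀ m.p₀ (x j k)) (covariateLaw d₁ d₂ m.p₀) := by
    simpa using integrable_pow_of_pow_four hsm.aemeasurable hs4 (k := 1) (by norm_num)
  have hg : Measurable fun z : Matrix (Fin d₁) (Fin d₂) ℝ × ℝ => z.2 * score₀ m.p₀ (z.1 j k) :=
    measurable_snd.mul (hsm.comp measurable_fst)
  have hmap : ∫ z, z.2 * score₀ m.p₀ (z.1 j k) ∂m.dataLaw =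
      ∫ z, (m.f (traceInner z.1 m.βstar) + z.2) * score₀ m.p₀ (z.1 j k)
        ∂((covariateLaw d₁ d₂ m.p₀).prod m.noise) :=
    integral_map m.measurable_response.aemeasurable hg.aestronglyMeasurable
  rw [hmap]
  simp only [add_mul]
  have i1 : Integrable (fun z : Matrix (Fin d₁) (Fin d₂) ℝ × ℝ =>
      m.f (traceInner z.1 m.βstar) * score₀ m.p₀ (z.1 j k))
      ((covariateLaw d₁ d₂ m.p₀).prod m.noise) := hFs.comp_fst m.noise
  have i2 : Integrable (fun z : Matrix (Fin d₁) (Fin d₂) ℝ × ℝ => z.2 * score₀ m.p₀ (z.1 j k))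
      ((covariateLaw d₁ d₂ m.p₀).prod m.noise) := by
    simpa only [mul_comm] using hs1.mul_prod m.noise_integrable
  rw [integral_add i1 i2]
  have e2 : ∫ z : Matrix (Fin d₁) (Fin d₂) ℝ × ℝ, z.2 * score₀ m.p₀ (z.1 j k)
      ∂((covariateLaw d₁ d₂ m.p₀).prod m.noise) = 0 := by
    have h3 := integral_prod_mul (μ := covariateLaw d₁ d₂ m.p₀) (ν := m.noise)
      (fun x => score₀ m.p₀ (x j k)) (fun e : ℝ => e)
    rw [m.noise_mean, mul_zero] at h3
    simpa only [mul_comm] using h3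
  have e1 : ∫ z : Matrix (Fin d₁) (Fin d₂) ℝ × ℝ,
      m.f (traceInner z.1 m.βstar) * score₀ m.p₀ (z.1 j k)
      ∂((covariateLaw d₁ d₂ m.p₀).prod m.noise) =
      ∫ x, m.f (traceInner x m.βstar) * score₀ m.p₀ (x j k) ∂(covariateLaw d₁ d₂ m.p₀) :=
    (measurePreserving_fst (μ := covariateLaw d₁ d₂ m.p₀)
      (ν := m.noise)).integral_comp_of_measurable (hF.mul hsm)
  rw [e1, e2, add_zero]
  exact integral_traceInner_mul_score₀ m.p₀_nonneg m.p₀_differentiable m.p₀_integral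
    m.f_differentiable m.βstar j k hFs m.link_integrable hF1

theorem MomentBound.score_row_pow_four (h : m.MomentBound M) (hM : 0 < M) (j : Fin d₁)
    (v : Fin d₂ → ℝ) :
    Integrable (fun x => (∑ k, score₀ m.p₀ (x j k) * v k) ^ 4) (covariateLaw d₁ d₂ m.p₀) ∧
      ∫ x, (∑ k, score₀ m.p₀ (x j k) * v k) ^ 4 ∂(covariateLaw d₁ d₂ m.p₀) ≤
        3 * M * (∑ k, v k ^ 2) ^ 2 := by
  have := m.isProbabilityMeasure_entryLaw
  have hsm := measurable_score₀ m.p₀_differentiable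
  have hev := fun k => measurePreserving_eval (fun _ : Fin d₂ => entryLaw m.p₀) k
  have hb := integral_linear_comb_pow_four_le
    (ν := Measure.pi fun _ : Fin d₂ => entryLaw m.p₀) (ξ := fun k x => score₀ m.p₀ (x k))
    (iIndepFun_pi fun k => hsm.aemeasurable) (fun k => hsm.comp (measurable_pi_apply k))
    (fun k => (hev k).integrable_comp_of_integrable h.score_integrable)
    (fun k => ((hev k).integral_comp_of_measurable hsm).trans h.integral_score₀) hM
    (fun k => ((hev k).integral_comp_of_measurable (hsm.pow_const 4)).trans_le h.score_bound) v
  have hmeas : Measurable fun x : Fin d₂ → ℝ => (∑ k, score₀ m.p₀ (x k) * v k) ^ 4 :=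
    (Finset.measurable_sum _ fun k _ =>
      (hsm.comp (measurable_pi_apply k)).mul_const _).pow_const 4
  exact ⟨(m.measurePreserving_row j).integrable_comp_of_integrable hb.1,
    ((m.measurePreserving_row j).integral_comp_of_measurable hmeas).trans_le hb.2⟩

theorem MomentBound.score_col_pow_four (h : m.MomentBound M) (hM : 0 < M) (k : Fin d₂)
    (v : Fin d₁ → ℝ) :
    Integrable (fun x => (∑ j, score₀ m.p₀ (x j k) * v j) ^ 4) (covariateLaw d₁ d₂ m.p₀) ∧
      ∫ x, (∑ j, score₀ m.p₀ (x j k) * v j) ^ 4 ∂(covariateLaw d₁ d₂ m.p₀) ≤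
        3 * M * (∑ j, v j ^ 2) ^ 2 := by
  have := m.isProbabilityMeasure_entryLaw
  have := m.isProbabilityMeasure_covariateLaw
  have hsm := measurable_score₀ m.p₀_differentiable
  have hen := fun j => m.measurePreserving_entry j k
  have hind : iIndepFun (fun (j : Fin d₁) (x : Matrix (Fin d₁) (Fin d₂) ℝ) => score₀ m.p₀ (x j k))
      (covariateLaw d₁ d₂ m.p₀) :=
    iIndepFun_pi (μ := fun _ : Fin d₁ => Measure.pi fun _ : Fin d₂ => entryLaw m.p₀)
      (X := fun _ row => score₀ m.p₀ (row k))
      fun j => (hsm.comp (measurable_pi_apply k)).aemeasurable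
  exact integral_linear_comb_pow_four_le hind (fun j => measurable_score_entry m j k)
    (fun j => h.integrable_score_pow_four j k)
    (fun j => ((hen j).integral_comp_of_measurable hsm).trans h.integral_score₀) hM
    (fun j => ((hen j).integral_comp_of_measurable (hsm.pow_const 4)).trans_le h.score_bound) v

/-- The product is split by `(yT)² ≤ (q/2) y⁴ + T⁴/(2q)`, weighted so that both terms scale like
`Mq`: `1/2 + 3/2 = 2`. -/
theorem MomentBound.response_sq_mul_sq (h : m.MomentBound M)
    {T : Matrix (Fin d₁) (Fin d₂) ℝ → ℝ} (hT : Measurable T)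
    (hTi : Integrable (fun x => T x ^ 4) (covariateLaw d₁ d₂ m.p₀)) {q : ℝ} (hq : 0 < q)
    (hTb : ∫ x, T x ^ 4 ∂(covariateLaw d₁ d₂ m.p₀) ≤ 3 * M * q ^ 2) :
    Integrable (fun z => (z.2 * T z.1) ^ 2) m.dataLaw ∧
      ∫ z, (z.2 * T z.1) ^ 2 ∂m.dataLaw ≤ 2 * M * q := by
  have := m.isProbabilityMeasure_dataLaw
  have hT4 : Integrable (fun z : Matrix (Fin d₁) (Fin d₂) ℝ × ℝ => T z.1 ^ 4) m.dataLaw :=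
    m.measurePreserving_fst_dataLaw.integrable_comp_of_integrable hTi
  have hT4b : ∫ z : Matrix (Fin d₁) (Fin d₂) ℝ × ℝ, T z.1 ^ 4 ∂m.dataLaw ≤ 3 * M * q ^ 2 :=
    (m.measurePreserving_fst_dataLaw.integral_comp_of_measurable (hT.pow_const 4)).trans_le hTb
  have hpt : ∀ z : Matrix (Fin d₁) (Fin d₂) ℝ × ℝ,
      (z.2 * T z.1) ^ 2 ≤ q / 2 * z.2 ^ 4 + 1 / (2 * q) * T z.1 ^ 4 := by
    intro z
    have h1 : 0 ≤ 1 / (2 * q) * (q * z.2 ^ 2 - T z.1 ^ 2) ^ 2 := by positivity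
    have h2 : 1 / (2 * q) * (q * z.2 ^ 2 - T z.1 ^ 2) ^ 2 =
        q / 2 * z.2 ^ 4 + 1 / (2 * q) * T z.1 ^ 4 - (z.2 * T z.1) ^ 2 := by
      field_simp
      ring
    linarith
  have hdom := (h.response_integrable.const_mul (q / 2)).fun_add (hT4.const_mul (1 / (2 * q)))
  have hint : Integrable (fun z => (z.2 * T z.1) ^ 2) m.dataLaw :=
    hdom.mono' ((measurable_snd.mul (hT.comp measurable_fst)).pow_const 2).aestronglyMeasurable
      (Filter.Eventually.of_forall fun z => by
        rw [Real.norm_eq_abs, abs_of_nonneg (sq_nonneg _)]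
        exact hpt z)
  refine ⟨hint, (integral_mono hint hdom hpt).trans ?_⟩
  rw [integral_add (h.response_integrable.const_mul (q / 2)) (hT4.const_mul (1 / (2 * q))),
    integral_const_mul, integral_const_mul]
  have h1 : q / 2 * ∫ z, z.2 ^ 4 ∂m.dataLaw ≤ q / 2 * M :=
    mul_le_mul_of_nonneg_left h.response_bound (by positivity)
  have h2 : 1 / (2 * q) * ∫ z : Matrix (Fin d₁) (Fin d₂) ℝ × ℝ, T z.1 ^ 4 ∂m.dataLaw ≤
      1 / (2 * q) * (3 * M * q ^ 2) := mul_le_mul_of_nonneg_left hT4b (by positivity)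
  have h3 : 1 / (2 * q) * (3 * M * q ^ 2) = 3 / 2 * M * q := by field_simp
  linarith

end MatrixSIM

end Moments

/-! ### The symmetric dilation. -/

section Dilation

variable {d₁ d₂ : ℕ}

theorem quad_fromBlocks (N : Matrix (Fin d₁ ⊕ Fin d₂) (Fin d₁ ⊕ Fin d₂) ℝ) (u : Fin d₁ → ℝ)
    (v : Fin d₂ → ℝ) :
    Sum.elim u v ⬝ᵥ (N *ᵥ Sum.elim u v) =
      u ⬝ᵥ (N.toBlocks₁₁ *ᵥ u) + u ⬝ᵥ (N.toBlocks₁₂ *ᵥ v) +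
        (v ⬝ᵥ (N.toBlocks₂₁ *ᵥ u) + v ⬝ᵥ (N.toBlocks₂₂ *ᵥ v)) := by
  conv_lhs => rw [← Matrix.fromBlocks_toBlocks N]
  rw [Matrix.fromBlocks_mulVec, sumElim_dotProduct_sumElim]
  simp [dotProduct_add]

/-- A bound on the quadratic form of a symmetric block matrix bounds the operator norm of its
off-diagonal block. -/
theorem toBlocks₁₂_mulVec_le {N : Matrix (Fin d₁ ⊕ Fin d₂) (Fin d₁ ⊕ Fin d₂) ℝ} (hN : Nᵀ = N)
    {t : ℝ} (ht : 0 < t) (h : ∀ w, |w ⬝ᵥ (N *ᵥ w)| ≤ t * (w ⬝ᵥ w)) (v : Fin d₂ → ℝ) :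
    (N.toBlocks₁₂ *ᵥ v) ⬝ᵥ (N.toBlocks₁₂ *ᵥ v) ≤ t ^ 2 * (v ⬝ᵥ v) := by
  have h21 : N.toBlocks₂₁ = N.toBlocks₁₂ᵀ := by
    ext i j
    exact (congrFun (congrFun hN (Sum.inr i)) (Sum.inl j)).symm
  have hbil : ∀ u : Fin d₁ → ℝ, 2 * (u ⬝ᵥ (N.toBlocks₁₂ *ᵥ v)) ≤ t * (u ⬝ᵥ u + v ⬝ᵥ v) := by
    intro u
    -- Comparing the test vectors `(u, v)` and `(u, -v)` cancels the diagonal blocks, which need not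
    -- vanish.
    have h1 := (abs_le.mp (h (Sum.elim u v))).2
    have h2 := (abs_le.mp (h (Sum.elim u (-v)))).1
    have h3 : v ⬝ᵥ (N.toBlocks₂₁ *ᵥ u) = u ⬝ᵥ (N.toBlocks₁₂ *ᵥ v) := by
      rw [h21, Matrix.mulVec_transpose, dotProduct_comm, Matrix.dotProduct_mulVec]
    rw [quad_fromBlocks, sumElim_dotProduct_sumElim] at h1 h2
    simp only [Matrix.mulVec_neg, dotProduct_neg, neg_dotProduct, neg_neg, h3] at h1 h2
    linarith
  set z := N.toBlocks₁₂ *ᵥ v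
  -- The choice `u = z/t` optimizes the bilinear bound.
  have h4 := hbil ((1 / t) • z)
  simp only [smul_dotProduct, dotProduct_smul, smul_eq_mul] at h4
  have h5 : t * (1 / t * (1 / t * (z ⬝ᵥ z)) + v ⬝ᵥ v) = 1 / t * (z ⬝ᵥ z) + t * (v ⬝ᵥ v) := by
    field_simp
  rw [h5] at h4
  have h6 : 1 / t * (z ⬝ᵥ z) ≤ t * (v ⬝ᵥ v) := by linarith
  have h7 := mul_le_mul_of_nonneg_left h6 ht.le
  have h8 : t * (1 / t * (z ⬝ᵥ z)) = z ⬝ᵥ z := by field_simp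
  rw [h8] at h7
  linarith

/-- The symmetric dilation of the weighted score matrix `c Y S(X)` of an observation. -/
noncomputable def scoreDilation (p₀ : ℝ → ℝ) (c : ℝ) (z : Matrix (Fin d₁) (Fin d₂) ℝ × ℝ) :
    Matrix (Fin d₁ ⊕ Fin d₂) (Fin d₁ ⊕ Fin d₂) ℝ :=
  Matrix.fromBlocks 0 ((c * z.2) • score p₀ z.1) ((c * z.2) • score p₀ z.1)ᵀ 0

theorem scoreDilation_isHermitian (p₀ : ℝ → ℝ) (c : ℝ) (z : Matrix (Fin d₁) (Fin d₂) ℝ × ℝ) :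
    (scoreDilation p₀ c z).IsHermitian :=
  dilation_isHermitian _

/-- For a symmetric matrix this is the squared norm of its value at `w`. The coordinates are row
sums of scores against the lower half of `w` and column sums against the upper half, each a
combination of independent scores. -/
theorem quad_scoreDilation_sq (p₀ : ℝ → ℝ) (c : ℝ) (z : Matrix (Fin d₁) (Fin d₂) ℝ × ℝ)
    (w : Fin d₁ ⊕ Fin d₂ → ℝ) :
    w ⬝ᵥ ((scoreDilation p₀ c z * scoreDilation p₀ c z) *ᵥ w) =
      c ^ 2 * (∑ j, (z.2 * ∑ k, score₀ p₀ (z.1 j k) * w (Sum.inr k)) ^ 2 +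
        ∑ k, (z.2 * ∑ j, score₀ p₀ (z.1 j k) * w (Sum.inl j)) ^ 2) := by
  have ht := transpose_eq_of_isHermitian (scoreDilation_isHermitian p₀ c z)
  conv_lhs => rw [← ht]
  rw [ht]
  conv_lhs =>
    enter [2, 1, 1]
    rw [← ht]
  rw [dotProduct_mulVec_transpose_mul, dotProduct, Fintype.sum_sum_type, mul_add, Finset.mul_sum,
    Finset.mul_sum]
  congr 1
  · refine Finset.sum_congr rfl fun j _ => ?_
    have : (scoreDilation p₀ c z *ᵥ w) (Sum.inl j) =
        c * (z.2 * ∑ k, score₀ p₀ (z.1 j k) * w (Sum.inr k)) := by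
      simp [scoreDilation, Matrix.mulVec, dotProduct, score, Finset.mul_sum, mul_assoc]
    rw [this]
    ring
  · refine Finset.sum_congr rfl fun k _ => ?_
    have : (scoreDilation p₀ c z *ᵥ w) (Sum.inr k) =
        c * (z.2 * ∑ j, score₀ p₀ (z.1 j k) * w (Sum.inl j)) := by
      simp [scoreDilation, Matrix.mulVec, dotProduct, score, Finset.mul_sum, mul_assoc]
    rw [this]
    ring

end Dilation

/-! ### Operator norm deviation of the averaged truncated scores. -/

section Deviation

variable {d₁ d₂ r : ℕ} {m : MatrixSIM d₁ d₂ r} {M : ℝ}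

namespace MatrixSIM

theorem MomentBound.response_mul_linear_sq (h : m.MomentBound M) {κ : Type*} [Fintype κ]
    {T : Matrix (Fin d₁) (Fin d₂) ℝ → κ → ℝ} (hTm : ∀ k, Measurable fun x => T x k) (v : κ → ℝ)
    (hT : Integrable (fun x => (∑ k, T x k * v k) ^ 4) (covariateLaw d₁ d₂ m.p₀) ∧
      ∫ x, (∑ k, T x k * v k) ^ 4 ∂(covariateLaw d₁ d₂ m.p₀) ≤ 3 * M * (∑ k, v k ^ 2) ^ 2) :
    Integrable (fun z => (z.2 * ∑ k, T z.1 k * v k) ^ 2) m.dataLaw ∧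
      ∫ z, (z.2 * ∑ k, T z.1 k * v k) ^ 2 ∂m.dataLaw ≤ 2 * M * ∑ k, v k ^ 2 := by
  rcases (Finset.sum_nonneg fun k _ => sq_nonneg (v k) :
    0 ≤ ∑ k, v k ^ 2).eq_or_lt with h0 | h0
  · have hv : ∀ k, v k = 0 := fun k => by
      have := (Finset.sum_eq_zero_iff_of_nonneg fun k _ => sq_nonneg (v k)).mp h0.symm k
        (Finset.mem_univ k)
      simpa using this
    simp [hv]
  · exact h.response_sq_mul_sq (T := fun x => ∑ k, T x k * v k)
      (Finset.measurable_sum _ fun k _ => (hTm k).mul_const _) hT.1 h0 hT.2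

theorem measurable_scoreDilation (m : MatrixSIM d₁ d₂ r) (c : ℝ) (i j : Fin d₁ ⊕ Fin d₂) :
    Measurable fun z => scoreDilation (d₁ := d₁) (d₂ := d₂) m.p₀ c z i j := by
  have hs : ∀ a b, Measurable fun z : Matrix (Fin d₁) (Fin d₂) ℝ × ℝ =>
      c * z.2 * score₀ m.p₀ (z.1 a b) := fun a b =>
    (measurable_snd.const_mul c).mul ((measurable_score_entry m a b).comp measurable_fst)
  rcases i with a | b <;> rcases j with a' | b'
  · exact measurable_const
  · exact hs a b'
  · exact hs a' b
  · exact measurable_const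

theorem MomentBound.integrable_response_mul_score_sq (h : m.MomentBound M) (hM : 0 < M)
    (a : Fin d₁) (b : Fin d₂) :
    Integrable (fun z => (z.2 * score₀ m.p₀ (z.1 a b)) ^ 2) m.dataLaw := by
  have := m.isProbabilityMeasure_entryLaw
  have hb := ((m.measurePreserving_entry a b).integral_comp_of_measurable
    ((measurable_score₀ m.p₀_differentiable).pow_const 4)).trans_le h.score_bound
  exact (h.response_sq_mul_sq (measurable_score_entry m a b) (h.integrable_score_pow_four a b)
    one_pos (by linarith)).1

theorem MomentBound.integrable_scoreDilation_sq (h : m.MomentBound M) (hM : 0 < M) (c : ℝ)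
    (i j : Fin d₁ ⊕ Fin d₂) :
    Integrable (fun z => scoreDilation m.p₀ c z i j ^ 2) m.dataLaw := by
  have hs : ∀ a b, Integrable (fun z => (c * z.2 * score₀ m.p₀ (z.1 a b)) ^ 2) m.dataLaw :=
    fun a b => by
      simpa only [mul_pow, mul_assoc] using
        (h.integrable_response_mul_score_sq hM a b).const_mul (c ^ 2)
  rcases i with a | b <;> rcases j with a' | b'
  · simp [scoreDilation]
  · exact hs a b'
  · exact hs a' b
  · simp [scoreDilation]

theorem MomentBound.integrable_scoreDilation (h : m.MomentBound M) (hM : 0 < M) (c : ℝ)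
    (i j : Fin d₁ ⊕ Fin d₂) :
    Integrable (fun z => scoreDilation m.p₀ c z i j) m.dataLaw := by
  have := m.isProbabilityMeasure_dataLaw
  refine ((integrable_const (1 : ℝ)).add (h.integrable_scoreDilation_sq hM c i j)).mono'
    (m.measurable_scoreDilation c i j).aestronglyMeasurable
    (Filter.Eventually.of_forall fun z => ?_)
  rw [Real.norm_eq_abs, Pi.add_apply, abs_le]
  constructor <;> nlinarith [sq_nonneg (scoreDilation m.p₀ c z i j + 1),
    sq_nonneg (scoreDilation m.p₀ c z i j - 1)]

theorem MomentBound.integrable_scoreDilation_mul_self (h : m.MomentBound M) (hM : 0 < M) (c : ℝ)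
    (i j : Fin d₁ ⊕ Fin d₂) :
    Integrable (fun z => (scoreDilation m.p₀ c z * scoreDilation m.p₀ c z) i j) m.dataLaw := by
  simp only [Matrix.mul_apply]
  refine integrable_finsetSum _ fun l _ => ?_
  refine ((h.integrable_scoreDilation_sq hM c i l).add
    (h.integrable_scoreDilation_sq hM c l j)).mono'
    ((m.measurable_scoreDilation c i l).mul (m.measurable_scoreDilation c l j)).aestronglyMeasurable
    (Filter.Eventually.of_forall fun z => ?_)
  rw [Real.norm_eq_abs, Pi.add_apply, abs_le]
  constructor <;> nlinarith [sq_nonneg (scoreDilation m.p₀ c z i l + scoreDilation m.p₀ c z l j),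
    sq_nonneg (scoreDilation m.p₀ c z i l - scoreDilation m.p₀ c z l j)]

theorem MomentBound.integral_quad_scoreDilation_le (h : m.MomentBound M) (hM : 0 < M) (c : ℝ)
    (w : Fin d₁ ⊕ Fin d₂ → ℝ) :
    ∫ z, w ⬝ᵥ ((scoreDilation m.p₀ c z * scoreDilation m.p₀ c z) *ᵥ w) ∂m.dataLaw ≤
      2 * (c ^ 2 * ((d₁ : ℝ) + d₂) * M) * (w ⬝ᵥ w) := by
  have hrow := fun j => h.response_mul_linear_sq (T := fun x k => score₀ m.p₀ (x j k))
    (fun k => measurable_score_entry m j k) (fun k => w (Sum.inr k))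
    (h.score_row_pow_four hM j fun k => w (Sum.inr k))
  have hcol := fun k => h.response_mul_linear_sq (T := fun x j => score₀ m.p₀ (x j k))
    (fun j => measurable_score_entry m j k) (fun j => w (Sum.inl j))
    (h.score_col_pow_four hM k fun j => w (Sum.inl j))
  simp only [quad_scoreDilation_sq]
  rw [integral_const_mul, integral_add (integrable_finsetSum _ fun j _ => (hrow j).1)
    (integrable_finsetSum _ fun k _ => (hcol k).1), integral_finsetSum _ fun j _ => (hrow j).1,
    integral_finsetSum _ fun k _ => (hcol k).1]
  have h1 := Finset.sum_le_sum fun j (_ : j ∈ Finset.univ) => (hrow j).2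
  have h2 := Finset.sum_le_sum fun k (_ : k ∈ Finset.univ) => (hcol k).2
  simp only [Finset.sum_const, Finset.card_univ, Fintype.card_fin, nsmul_eq_mul] at h1 h2
  have hw : w ⬝ᵥ w = ∑ j, w (Sum.inl j) ^ 2 + ∑ k, w (Sum.inr k) ^ 2 := by
    rw [dotProduct, Fintype.sum_sum_type]
    simp only [pow_two]
  rw [hw]
  set A := ∑ j, w (Sum.inl j) ^ 2
  set B := ∑ k, w (Sum.inr k) ^ 2
  have hA : 0 ≤ A := Finset.sum_nonneg fun _ _ => sq_nonneg _
  have hB : 0 ≤ B := Finset.sum_nonneg fun _ _ => sq_nonneg _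
  -- The `d₁` rows see only the lower half of `w` and the `d₂` columns only the upper half; both
  -- counts are relaxed to `d₁ + d₂`.
  have h3 : (d₁ : ℝ) * (2 * M * B) + d₂ * (2 * M * A) ≤ 2 * (((d₁ : ℝ) + d₂) * M) * (A + B) := by
    have e1 : 0 ≤ (d₁ : ℝ) * (2 * M * A) := by positivity
    have e2 : 0 ≤ (d₂ : ℝ) * (2 * M * B) := by positivity
    nlinarith
  calc _ ≤ c ^ 2 * (2 * (((d₁ : ℝ) + d₂) * M) * (A + B)) :=
        mul_le_mul_of_nonneg_left (by linarith) (sq_nonneg c)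
    _ = _ := by ring

theorem MomentBound.meanMatrix_scoreDilation (h : m.MomentBound M) (c : ℝ) :
    meanMatrix m.dataLaw (scoreDilation m.p₀ c) =
      Matrix.fromBlocks 0 ((c * m.mu) • m.βstar) ((c * m.mu) • m.βstar)ᵀ 0 := by
  have hs : ∀ a b, ∫ z, c * z.2 * score₀ m.p₀ (z.1 a b) ∂m.dataLaw = c * m.mu * m.βstar a b :=
    fun a b => by
      simp only [mul_assoc]
      rw [integral_const_mul, h.integral_response_mul_score]
  ext i j
  rcases i with a | b <;> rcases j with a' | b'
  · simp [meanMatrix, scoreDilation]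
  · exact hs a b'
  · exact hs a' b
  · simp [meanMatrix, scoreDilation]

/-- With high probability the averaged truncated score matrix is close to `μ β*` in operator
norm. -/
theorem MomentBound.measure_operator_deviation_le (h : m.MomentBound M) (hM : 0 < M) {φ : ℝ → ℝ}
    (hφ : IsInfluence φ) {c : ℝ} (hc : 0 < c) {n : ℕ} (hn : 0 < n) {s : ℝ} (hs : 0 < s) :
    (Measure.pi fun _ : Fin n => m.dataLaw) {z | ¬ ∀ v,
        (((1 / (n : ℝ)) • ∑ i, truncated φ m.p₀ c (z i).2 (z i).1 - m.mu • m.βstar) *ᵥ v) ⬝ᵥ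
        (((1 / (n : ℝ)) • ∑ i, truncated φ m.p₀ c (z i).2 (z i).1 - m.mu • m.βstar) *ᵥ v) ≤
          ((2 * s + n * (c ^ 2 * ((d₁ : ℝ) + d₂) * M)) / (n * c)) ^ 2 * (v ⬝ᵥ v)} ≤
      ENNReal.ofReal (2 * ((1 + c ^ 2 * ((d₁ : ℝ) + d₂) * M) ^ n * ((d₁ : ℝ) + d₂) *
        Real.exp (-s))) := by
  have := m.isProbabilityMeasure_dataLaw
  have hn' : (0 : ℝ) < n := by exact_mod_cast hn
  have hdev := hφ.measure_deviation_le (μ := m.dataLaw) (scoreDilation_isHermitian m.p₀ c)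
    (m.measurable_scoreDilation c) (h.integrable_scoreDilation hM c)
    (h.integrable_scoreDilation_mul_self hM c) (ρ := c ^ 2 * ((d₁ : ℝ) + d₂) * M) (by positivity)
    (h.integral_quad_scoreDilation_le hM c) n s
  rw [Fintype.card_sum, Fintype.card_fin, Fintype.card_fin, Nat.cast_add] at hdev
  refine le_trans (measure_mono ?_) hdev
  intro z hz hall
  refine hz fun v => ?_
  set N := ∑ i, (scoreDilation_isHermitian m.p₀ c (z i)).cfc φ -
    (n : ℝ) • meanMatrix m.dataLaw (scoreDilation m.p₀ c) with hNdef
  set t := 2 * s + n * (c ^ 2 * ((d₁ : ℝ) + d₂) * M)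
  have ht : 0 < t := by positivity
  have hNt : Nᵀ = N := by
    rw [hNdef, Matrix.transpose_sub, Matrix.transpose_smul,
      transpose_eq_of_isHermitian (sum_isHermitian fun i => cfc_isHermitian _ φ),
      transpose_meanMatrix _ fun z => transpose_eq_of_isHermitian (scoreDilation_isHermitian _ c z)]
  have hb := toBlocks₁₂_mulVec_le hNt ht hall v
  -- By Stein's identity the dilated scores have mean `c μ β*` in this block; dividing by `n c`
  -- recovers the error of the average.
  have hW : (1 / (n : ℝ)) • ∑ i, truncated φ m.p₀ c (z i).2 (z i).1 - m.mu • m.βstar =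
      (1 / (n * c)) • N.toBlocks₁₂ := by
    ext a b
    rw [hNdef, h.meanMatrix_scoreDilation]
    simp only [Matrix.sub_apply, Matrix.smul_apply, Matrix.sum_apply, truncated, spectralTrunc,
      Matrix.toBlocks₁₂, Matrix.of_apply, Matrix.fromBlocks_apply₁₂, smul_eq_mul,
      ← Finset.mul_sum]
    have : ∀ x : ℝ, 1 / (n : ℝ) * (1 / c * x) - m.mu * m.βstar a b =
        1 / (n * c) * (x - n * (c * m.mu * m.βstar a b)) := fun x => by field_simp
    exact this _
  rw [hW, Matrix.smul_mulVec, smul_dotProduct, dotProduct_smul, smul_eq_mul, smul_eq_mul]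
  calc _ = (1 / (n * c)) ^ 2 * ((N.toBlocks₁₂ *ᵥ v) ⬝ᵥ (N.toBlocks₁₂ *ᵥ v)) := by ring
    _ ≤ (1 / (n * c)) ^ 2 * (t ^ 2 * (v ⬝ᵥ v)) := mul_le_mul_of_nonneg_left hb (sq_nonneg _)
    _ = _ := by ring

end MatrixSIM

end Deviation

/-! ### Choice of constants and conclusion. -/

section Main

variable {d₁ d₂ r : ℕ}

/-- A matrix of norm 1 is not empty. This makes `log (d₁ + d₂)` positive and absorbs the factor 2 in
the failure probability. -/
theorem MatrixSIM.two_le_dim (m : MatrixSIM d₁ d₂ r) : 2 ≤ (d₁ : ℝ) + d₂ := by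
  have hne : m.βstar ≠ 0 := fun h0 => by
    have h := m.norm_βstar
    rw [h0, norm_zero] at h
    exact zero_ne_one h
  have h1 : d₁ ≠ 0 := by
    rintro rfl
    exact hne (Matrix.ext fun i => i.elim0)
  have h2 : d₂ ≠ 0 := by
    rintro rfl
    exact hne (Matrix.ext fun _ j => j.elim0)
  have h3 : 2 ≤ d₁ + d₂ := by omega
  exact_mod_cast h3

theorem kappa_sq {d₁ d₂ n : ℕ} {M : ℝ} (hd : 2 ≤ (d₁ : ℝ) + d₂) (hn : 0 < n) (hM : 0 < M) :
    0 < kappa d₁ d₂ n M ∧ kappa d₁ d₂ n M ^ 2 * ((d₁ : ℝ) + d₂) * M =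
      4 * Real.log ((d₁ : ℝ) + d₂) / n := by
  have hn' : (0 : ℝ) < n := by exact_mod_cast hn
  have hL : 0 < Real.log ((d₁ : ℝ) + d₂) := Real.log_pos (by linarith)
  have hD : 0 < (d₁ : ℝ) + d₂ := by linarith
  refine ⟨by unfold kappa; positivity, ?_⟩
  rw [kappa, div_pow, mul_pow, Real.sq_sqrt hL.le, Real.sq_sqrt (by positivity)]
  field_simp
  ring

/-- The product is at most `2 · D⁴ · D · D⁻⁸ = 2 D⁻³`, and `2 ≤ D`. -/
theorem failure_probability_le {D : ℝ} (hD : 2 ≤ D) {n : ℕ} (hn : 0 < n) :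
    2 * ((1 + 4 * Real.log D / n) ^ n * D * Real.exp (-(8 * Real.log D))) ≤ 1 / D ^ 2 := by
  have hD0 : 0 < D := by linarith
  have hn' : (0 : ℝ) < n := by exact_mod_cast hn
  have hL : 0 < Real.log D := Real.log_pos (by linarith)
  have h1 : (1 + 4 * Real.log D / n) ^ n ≤ D ^ 4 := by
    have h2 : 1 + 4 * Real.log D / n ≤ Real.exp (4 * Real.log D / n) := by
      linarith [Real.add_one_le_exp (4 * Real.log D / n)]
    refine (pow_le_pow_left₀ (by positivity) h2 n).trans_eq ?_
    rw [← Real.exp_nat_mul, mul_div_cancel₀ _ hn'.ne', show (4 : ℝ) = ((4 : ℕ) : ℝ) by norm_num,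
      Real.exp_nat_mul, Real.exp_log hD0]
  have h3 : Real.exp (-(8 * Real.log D)) = 1 / D ^ 8 := by
    rw [Real.exp_neg, show (8 : ℝ) = ((8 : ℕ) : ℝ) by norm_num, Real.exp_nat_mul,
      Real.exp_log hD0, one_div]
  rw [h3]
  calc 2 * ((1 + 4 * Real.log D / n) ^ n * D * (1 / D ^ 8)) ≤ 2 * (D ^ 4 * D * (1 / D ^ 8)) := by
        gcongr
    _ = 2 / D * (1 / D ^ 2) := by field_simp
    _ ≤ 1 * (1 / D ^ 2) := by
        gcongr
        rw [div_le_one hD0]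
        exact hD
    _ = 1 / D ^ 2 := one_mul _

/-- With `L = log (d₁ + d₂)` the numerator is `16 L + 4 L`; dividing by `n κ` gives `10
√(M(d₁+d₂)L/n)`. Squaring removes the roots. -/
theorem deviation_eq_lambda {d₁ d₂ n : ℕ} {M : ℝ} (hd : 2 ≤ (d₁ : ℝ) + d₂) (hn : 0 < n)
    (hM : 0 < M) :
    ((2 * (8 * Real.log ((d₁ : ℝ) + d₂)) + n * (kappa d₁ d₂ n M ^ 2 * ((d₁ : ℝ) + d₂) * M)) /
      (n * kappa d₁ d₂ n M)) ^ 2 = (lambda d₁ d₂ n M 40 / 4) ^ 2 := by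
  have hn' : (0 : ℝ) < n := by exact_mod_cast hn
  have hL : 0 < Real.log ((d₁ : ℝ) + d₂) := Real.log_pos (by linarith)
  have hD : 0 < (d₁ : ℝ) + d₂ := by linarith
  rw [(kappa_sq hd hn hM).2, div_pow, mul_pow, kappa, div_pow, mul_pow, Real.sq_sqrt hL.le,
    Real.sq_sqrt (by positivity), lambda, div_pow, mul_pow, Real.sq_sqrt (by positivity)]
  field_simp
  ring

theorem IsEstimator.error_bound {n : ℕ} {φ p₀ : ℝ → ℝ} {c lam : ℝ}
    {x : Fin n → Matrix (Fin d₁) (Fin d₂) ℝ} {y : Fin n → ℝ} {β B : Matrix (Fin d₁) (Fin d₂) ℝ}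
    (hβ : IsEstimator φ p₀ c lam x y β) (hlam : 0 ≤ lam)
    (hW : ∀ v, (((1 / (n : ℝ)) • ∑ i, truncated φ p₀ c (y i) (x i) - B) *ᵥ v) ⬝ᵥ
      (((1 / (n : ℝ)) • ∑ i, truncated φ p₀ c (y i) (x i) - B) *ᵥ v) ≤
        (lam / 4) ^ 2 * (v ⬝ᵥ v)) :
    ‖β - B‖ ≤ 2 * √(B.rank : ℝ) * lam ∧ nuclearNorm (β - B) ≤ 6 * B.rank * lam := by
  refine penalized_error_bound hlam hW ?_
  have hloss : ∀ b, loss (fun i => truncated φ p₀ c (y i) (x i)) b =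
      traceInner b b - 2 * traceInner (B + ((1 / (n : ℝ)) •
        ∑ i, truncated φ p₀ c (y i) (x i) - B)) b := by
    intro b
    have hsum : traceInner (∑ i, truncated φ p₀ c (y i) (x i)) b =
        ∑ i, traceInner (truncated φ p₀ c (y i) (x i)) b := by
      simp only [traceInner, Matrix.transpose_sum, Matrix.sum_mul, Matrix.trace_sum]
    rw [add_sub_cancel, loss, ← hsum]
    simp only [traceInner, Matrix.transpose_smul, Matrix.smul_mul, Matrix.trace_smul, smul_eq_mul]
    ring
  have h := hβ (Set.mem_univ B)
  simp only [Set.mem_ofPred_eq, hloss] at h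
  exact h

end Main

end LowRankSIM

theorem theorem2 :
    ∃ C : ℝ, 0 < C ∧
      ∀ (d₁ d₂ r n : ℕ) (_ : 1 ≤ n) (m : MatrixSIM d₁ d₂ r)
        (M : ℝ) (_ : 0 < M) (_ : m.MomentBound M)
        (φ : ℝ → ℝ) (_ : IsInfluence φ)
        (Ω : Type*) [MeasurableSpace Ω] (P : Measure Ω) [IsProbabilityMeasure P]
        (X : Fin n → Ω → Matrix (Fin d₁) (Fin d₂) ℝ) (Y : Fin n → Ω → ℝ)
        (_ : m.IsSample P X Y)
        (βhat : Ω → Matrix (Fin d₁) (Fin d₂) ℝ)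
        (_ : ∀ ω, IsEstimator φ m.p₀ (kappa d₁ d₂ n M) (lambda d₁ d₂ n M C)
          (fun i => X i ω) (fun i => Y i ω) (βhat ω)),
        1 - 1 / ((d₁ : ℝ) + d₂) ^ 2 ≤
          P.real {ω | ‖βhat ω - m.mu • m.βstar‖ ≤ 3 * √(r : ℝ) * lambda d₁ d₂ n M C ∧
            nuclearNorm (βhat ω - m.mu • m.βstar) ≤ 12 * (r : ℝ) * lambda d₁ d₂ n M C} := by
  refine ⟨40, by norm_num, ?_⟩
  intro d₁ d₂ r n hn m M hM h φ hφ Ω _ P _ X Y hXY βhat hβ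
  have hd := m.two_le_dim
  have hn0 : 0 < n := hn
  have hL : 0 < Real.log ((d₁ : ℝ) + d₂) := Real.log_pos (by linarith)
  obtain ⟨hκ, hκ2⟩ := kappa_sq hd hn0 hM
  have hlam : 0 ≤ lambda d₁ d₂ n M 40 := by unfold lambda; positivity
  have hbad := h.measure_operator_deviation_le hM hφ hκ hn0
    (s := 8 * Real.log ((d₁ : ℝ) + d₂)) (by positivity)
  rw [deviation_eq_lambda hd hn0 hM, hκ2] at hbad
  set bad : Set (Fin n → Matrix (Fin d₁) (Fin d₂) ℝ × ℝ) := {z | ¬ ∀ v,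
    (((1 / (n : ℝ)) • ∑ i, truncated φ m.p₀ (kappa d₁ d₂ n M) (z i).2 (z i).1 -
        m.mu • m.βstar) *ᵥ v) ⬝ᵥ
      (((1 / (n : ℝ)) • ∑ i, truncated φ m.p₀ (kappa d₁ d₂ n M) (z i).2 (z i).1 -
        m.mu • m.βstar) *ᵥ v) ≤ (lambda d₁ d₂ n M 40 / 4) ^ 2 * (v ⬝ᵥ v)} with hbad_def
  set good := {ω | ‖βhat ω - m.mu • m.βstar‖ ≤ 3 * √(r : ℝ) * lambda d₁ d₂ n M 40 ∧
    nuclearNorm (βhat ω - m.mu • m.βstar) ≤ 12 * (r : ℝ) * lambda d₁ d₂ n M 40}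
  have hae : ∀ i, AEMeasurable (fun ω => (X i ω, Y i ω)) P := fun i => (hXY.hasLaw i).aemeasurable
  have hlaw : P.map (fun ω i => (X i ω, Y i ω)) = Measure.pi fun _ : Fin n => m.dataLaw := by
    rw [(iIndepFun_iff_map_fun_eq_pi_map hae).mp hXY.indep]
    congr 1
    funext i
    exact (hXY.hasLaw i).map_eq
  have hPbad : P ((fun ω i => (X i ω, Y i ω)) ⁻¹' bad) ≤
      ENNReal.ofReal (1 / ((d₁ : ℝ) + d₂) ^ 2) := by
    -- Neither `bad` nor the good event is known to be measurable, as `βhat` is an arbitrary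
    -- selection of minimizers. Only an inequality valid for all sets, monotonicity and
    -- subadditivity are used.
    refine (Measure.le_map_apply (aemeasurable_pi_lambda _ hae) bad).trans ?_
    rw [hlaw]
    exact hbad.trans (ENNReal.ofReal_le_ofReal (failure_probability_le hd hn0))
  have hcover : Set.univ ⊆ good ∪ (fun ω i => (X i ω, Y i ω)) ⁻¹' bad := by
    intro ω _
    by_cases hω : (fun i => (X i ω, Y i ω)) ∈ bad
    · exact Or.inr hω
    · refine Or.inl ?_
      obtain ⟨e1, e2⟩ := (hβ ω).error_bound hlam (not_not.mp hω)
      have hrank : ((m.mu • m.βstar).rank : ℝ) ≤ r := by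
        have h1 : m.mu • m.βstar = (m.mu • (1 : Matrix (Fin d₁) (Fin d₁) ℝ)) * m.βstar := by
          rw [Matrix.smul_mul, Matrix.one_mul]
        have h2 := Matrix.rank_mul_le_right (m.mu • (1 : Matrix (Fin d₁) (Fin d₁) ℝ)) m.βstar
        rw [← h1, m.rank_βstar] at h2
        exact_mod_cast h2
      constructor
      · refine e1.trans (mul_le_mul_of_nonneg_right ?_ hlam)
        have := Real.sqrt_le_sqrt hrank
        linarith [Real.sqrt_nonneg (r : ℝ)]
      · refine e2.trans (mul_le_mul_of_nonneg_right ?_ hlam)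
        have : (0 : ℝ) ≤ r := Nat.cast_nonneg r
        linarith
  have htotal : (1 : ENNReal) ≤ P good + ENNReal.ofReal (1 / ((d₁ : ℝ) + d₂) ^ 2) := by
    rw [← measure_univ (μ := P)]
    exact (measure_mono hcover).trans ((measure_union_le _ _).trans (by gcongr))
  have hreal := ENNReal.toReal_mono
    (ENNReal.add_ne_top.mpr ⟨measure_ne_top P good, ENNReal.ofReal_ne_top⟩) htotal
  rw [ENNReal.toReal_one, ENNReal.toReal_add (measure_ne_top P good) ENNReal.ofReal_ne_top,
    ENNReal.toReal_ofReal (by positivity)] at hreal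
  rw [Measure.real]
  linarith
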